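/- Let $p,q\in\mathbb{R}$ with $p\neq 0$, and let $P:\mathbb{R}\to\mathbb{R}$ be a Schwartz function of compact support. Write $\check P(\xi)=\int_{\mathbb{R}}e^{2\pi i k\xi}P(k)\,dk$ and, for $X\in\mathbb{R}$, $t\ge 0$ and $\operatorname{Re}\omega>0$, $$h(X,t)=2q\,\sin(2\pi^2pX^2t)\,\check P(2\pi pXt),\qquad \tilde h(X,\omega)=\int_0^\infty e^{-\omega t}h(X,t)\,dt .$$ Call $P$ stable with constant $\kappa>0$ if $$\inf_{\operatorname{Re}\omega>0,\;X\in\mathbb{R}}|1-\tilde h(X,\omega)|\ \ge\ \kappa ,$$ and assume that $P$ is stable with some constant $\kappa>0$. For $w_0\in\mathcal{S}(\mathbb{R}^2)$ consider solutions $w\in C([0,\infty);\mathcal{S}(\mathbb{R}^2))$ (complex-valued, differentiable in $t$ at each $(x,k)$ and $t>0$) of the linearised Alber equation $$\partial_t w+2\pi p k\,\partial_x w-qi\int_{\mathbb{R}}\Big(\int_{\mathbb{R}} e^{-2\pi i\lambda y}\big[n(x+\tfrac y2,t)-n(x-\tfrac y2,t)\big]dy\Big)P(k-\lambda)\,d\lambda=0,$$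 $$n(x,t)=\int_{\mathbb{R}}w(x,\xi,t)\,d\xi,\qquad w(x,k,0)=w_0(x,k).$$ For $r\in\mathbb{N}$ let $$\|w_0\|_{\Sigma^{r,\infty}}=\sum_{a+b+c+d\le r}\|x^ak^b\partial_x^c\partial_k^d w_0\|_{L^\infty(\mathbb{R}^2)} .$$ Then: (i) There are $r\in\mathbb{N}$ and $C>0$, depending only on $p,q,P$, such that for every $\kappa$ with which $P$ is stable, every $w_0\in\mathcal{S}(\mathbb{R}^2)$ and every such solution $w$ with initial datum $w_0$, $$\|\partial_x n\|_{L^2(\mathbb{R}_x\times(0,\infty)_t)}\le\frac{C}{\kappa}\,\|w_0\|_{\Sigma^{r,\infty}} .$$ (ii) Let $(E(t)g)(x,k)=g(x-2\pi pkt,k)$ be the free-space propagator. There is a linear operator $\mathbb{W}:\mathcal{S}(\mathbb{R}^2)\to L^\infty(\mathbb{R}^2)$ (the wave operator) such that for every $w_0\in\mathcal{S}(\mathbb{R}^2)$ and every such solution $w$ with initial datum $w_0$, $$\lim_{t\to\infty}\|w(t)-E(t)\mathbb{W}(w_0)\|_{L^\infty(\mathbb{R}^2)}=0 .$$ -/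

import Mathlib

open MeasureTheory
open scoped SchwartzMap FourierTransform ENNReal

noncomputable section

namespace Alber

/-- The `Σ^{s,p}` norm on functions of phase space `(x, k) ∈ ℝ × ℝ`:
the sum over `a + b + c + d ≤ s` of the `L^p(ℝ²)` norms of `x^a k^b ∂_x^c ∂_k^d f`. -/
def sigmaNorm (s : ℕ) (p : ℝ≥0∞) (f : ℝ × ℝ → ℂ) : ℝ≥0∞ :=
  ∑ a ∈ Finset.range (s + 1), ∑ b ∈ Finset.range (s + 1),
    ∑ c ∈ Finset.range (s + 1), ∑ d ∈ Finset.range (s + 1),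
      if a + b + c + d ≤ s then
        eLpNorm (fun z : ℝ × ℝ => (z.1 : ℂ) ^ a * (z.2 : ℂ) ^ b *
          iteratedDeriv c (fun x => iteratedDeriv d (fun k => f (x, k)) z.2) z.1) p volume
      else 0

/-- The Laplace transform `ω ↦ ∫_0^∞ e^{-ω t} u(t) dt`. -/
def laplace (u : ℝ → ℂ) (ω : ℂ) : ℂ :=
  ∫ t in Set.Ioi (0 : ℝ), Complex.exp (-ω * t) * u t

/-- The kernel `h(X,t) = 2 q sin(2π² p X² t) P̌(2π p X t)`,
where `P̌(ξ) = ∫ e^{2π i k ξ} P(k) dk`. -/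
def kernelH (p q : ℝ) (P : ℝ → ℝ) (X t : ℝ) : ℂ :=
  2 * q * Real.sin (2 * Real.pi ^ 2 * p * X ^ 2 * t) *
    𝓕⁻ (fun k : ℝ => (P k : ℂ)) (2 * Real.pi * p * X * t)

/-- The spectrum `P` is stable with constant `κ`:
`κ > 0` and `inf_{Re ω > 0, X ∈ ℝ} |1 - h̃(X,ω)| ≥ κ`. -/
def StableWith (p q : ℝ) (P : ℝ → ℝ) (κ : ℝ) : Prop :=
  0 < κ ∧ ∀ (X : ℝ) (ω : ℂ), 0 < ω.re → κ ≤ ‖1 - laplace (kernelH p q P X) ω‖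

/-- The position density `n(x) = ∫ w(x,ξ) dξ` of a phase-space function. -/
def density (w : ℝ × ℝ → ℂ) (x : ℝ) : ℂ :=
  ∫ ξ : ℝ, w (x, ξ)

/-- The interaction term
`∫_λ (∫_y e^{-2π i λ y} [n(x + y/2) - n(x - y/2)] dy) P(k - λ) dλ`. -/
def interaction (P : ℝ → ℝ) (n : ℝ → ℂ) (x k : ℝ) : ℂ :=
  ∫ l : ℝ, (∫ y : ℝ, Complex.exp (-2 * Real.pi * Complex.I * l * y) *
    (n (x + y / 2) - n (x - y / 2))) * P (k - l)

/-- `w ∈ C([0,∞); 𝓢(ℝ²))` is a classical solution of the linearised Alber equation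
`∂_t w + 2π p k ∂_x w - q i ∫∫ e^{-2π i λ y} [n(x+y/2,t) - n(x-y/2,t)] dy P(k-λ) dλ = 0`,
`n(x,t) = ∫ w(x,ξ,t) dξ`, with initial datum `w₀`.  Only the times `t ≥ 0` matter. -/
structure IsSolution (p q : ℝ) (P : ℝ → ℝ) (w₀ : 𝓢(ℝ × ℝ, ℂ)) (w : ℝ → 𝓢(ℝ × ℝ, ℂ)) :
    Prop where
  continuousOn : ContinuousOn w (Set.Ici 0)
  initial : w 0 = w₀
  equation : ∀ t : ℝ, 0 < t → ∀ x k : ℝ,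
    DifferentiableAt ℝ (fun τ => w τ (x, k)) t ∧
    deriv (fun τ => w τ (x, k)) t
      + 2 * Real.pi * p * k * deriv (fun y => w t (y, k)) x
      - q * Complex.I * interaction P (density (w t)) x k = 0

/-- The free-space propagator `E(t) : g(x,k) ↦ g(x - 2π p k t, k)`. -/
def freeTransport (p t : ℝ) (g : ℝ × ℝ → ℂ) : ℝ × ℝ → ℂ :=
  fun z => g (z.1 - 2 * Real.pi * p * z.2 * t, z.2)

end Alber

end

/-
Taking the Fourier transform in `x` and solving along the free transport turns the equation, at each
frequency `X`, into a scalar Volterra equation `u = f + h(-X, ·) * u` in time for `u = n̂(X, ·)`,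
where `f` is the Fourier transform of `w₀` along a line. Stability bounds the Fourier multiplier
`1 - h̃` below on every line `Re ω = σ > 0`, so Plancherel gives `κ ‖u‖₂ ≤ ‖f‖₂`, first with
exponential weights and then, as the weights tend to `1`, without; Plancherel in `x` yields (i).
The same inequality for `t u`, whose defect is controlled by the first moment of `h`, shows that
`u (X, ·)` is integrable in time with `|X| ‖u (X, ·)‖₁` integrable in `X`. Hence the Duhamel
integral for `w` converges absolutely and uniformly as `t → ∞`, and its limit, transported back by
the free flow, is the wave operator. The Volterra equation has exactly one continuous solution for
every datum, whether or not a solution `w` is given, so the wave operator is defined on all data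
and is linear.
-/

namespace Alber

open Set Filter Topology ContinuousLinearMap
open scoped Convolution BoundedContinuousFunction

section Plancherel

variable {E F : Type*} [NormedAddCommGroup E] [InnerProductSpace ℝ E] [FiniteDimensional ℝ E]
  [MeasurableSpace E] [BorelSpace E] [NormedAddCommGroup F] [InnerProductSpace ℂ F]
  [CompleteSpace F] {f : E → F}

theorem coeFn_fourier_toLp_two (h1 : Integrable f) (h2 : MemLp f 2) :
    (𝓕 (h2.toLp f) : Lp F 2 (volume : Measure E)) =ᵐ[volume] 𝓕 f := by
  have hcont : Continuous (𝓕 f) :=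
    VectorFourier.fourierIntegral_continuous Real.continuous_fourierChar
      (by exact continuous_inner) h1
  refine ae_eq_of_integral_contDiff_smul_eq
    ((Lp.memLp _).locallyIntegrable (by norm_num)) hcont.locallyIntegrable fun g hg hgc => ?_
  let G : 𝓢(E, ℂ) := (hgc.comp_left (g := fun r : ℝ => (r : ℂ)) (by simp)).toSchwartzMap
    (Complex.ofRealCLM.contDiff.comp hg)
  have hduality := congrArg (fun T : 𝓢'(E, F) => T G)
    (Lp.fourier_toTemperedDistribution_eq (h2.toLp f))
  simp only [TemperedDistribution.fourier_apply, Lp.toTemperedDistribution_apply] at hduality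
  have hswap : ∫ x, (𝓕 G) x • f x = ∫ x, G x • 𝓕 f x := by
    have := VectorFourier.integral_fourierIntegral_smul_eq_flip (μ := volume) (ν := volume)
      (L := innerₗ E) Real.continuous_fourierChar (by exact continuous_inner)
      (G.integrable (μ := volume)) h1
    rwa [flip_innerₗ] at this
  calc ∫ x, g x • (𝓕 (h2.toLp f) : Lp F 2 (volume : Measure E)) x
      = ∫ x, G x • (𝓕 (h2.toLp f) : Lp F 2 (volume : Measure E)) x := rfl
    _ = ∫ x, (𝓕 G) x • h2.toLp f x := hduality.symm
    _ = ∫ x, (𝓕 G) x • f x :=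
        integral_congr_ae (h2.coeFn_toLp.mono fun x hx => by simp only [hx])
    _ = ∫ x, g x • 𝓕 f x := hswap

theorem eLpNorm_fourier_two (h1 : Integrable f) (h2 : MemLp f 2) :
    eLpNorm (𝓕 f) 2 volume = eLpNorm f 2 volume := by
  rw [← eLpNorm_congr_ae (coeFn_fourier_toLp_two h1 h2), ← eLpNorm_congr_ae h2.coeFn_toLp,
    ← ENNReal.toReal_eq_toReal_iff' (Lp.eLpNorm_ne_top _) (Lp.eLpNorm_ne_top _)]
  exact Lp.norm_fourier_eq (h2.toLp f)

end Plancherel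

section Young

theorem sq_lintegral_mul_le {α : Type*} [MeasurableSpace α] {μ : Measure α} {a b : α → ℝ≥0∞}
    (ha : AEMeasurable a μ) (hb : AEMeasurable b μ) :
    (∫⁻ x, a x * b x ∂μ) ^ 2 ≤ (∫⁻ x, a x ∂μ) * ∫⁻ x, a x * b x ^ 2 ∂μ := by
  have hsq (x : ℝ≥0∞) : (x ^ (1 / 2 : ℝ)) ^ 2 = x := by
    rw [← ENNReal.rpow_natCast, ← ENNReal.rpow_mul]; norm_num
  have h := ENNReal.lintegral_mul_le_Lp_mul_Lq μ Real.HolderConjugate.two_two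
    (ha.pow_const (1 / 2 : ℝ)) ((ha.pow_const (1 / 2 : ℝ)).mul hb)
  simp only [Pi.mul_apply, ← mul_assoc, ENNReal.rpow_two, mul_pow, hsq, ← pow_two] at h
  calc (∫⁻ x, a x * b x ∂μ) ^ 2
      ≤ ((∫⁻ x, a x ∂μ) ^ (1 / 2 : ℝ) * (∫⁻ x, a x * b x ^ 2 ∂μ) ^ (1 / 2 : ℝ)) ^ 2 := by gcongr
    _ = _ := by rw [mul_pow, hsq, hsq]

variable {G : Type*} [AddCommGroup G] [MeasurableSpace G] [MeasurableAdd₂ G] [MeasurableNeg G]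
  {μ : Measure G} [SFinite μ] [μ.IsAddLeftInvariant] [μ.IsNegInvariant]

theorem lintegral_sq_lconv_le {a b : G → ℝ≥0∞} (ha : Measurable a) (hb : Measurable b) :
    ∫⁻ t, (∫⁻ s, a (t - s) * b s ∂μ) ^ 2 ∂μ ≤ (∫⁻ t, a t ∂μ) ^ 2 * ∫⁻ t, b t ^ 2 ∂μ := by
  have hm : Measurable fun z : G × G => a (z.1 - z.2) * b z.2 ^ 2 := by fun_prop
  calc ∫⁻ t, (∫⁻ s, a (t - s) * b s ∂μ) ^ 2 ∂μ
      ≤ ∫⁻ t, (∫⁻ s, a s ∂μ) * ∫⁻ s, a (t - s) * b s ^ 2 ∂μ ∂μ := lintegral_mono fun t => by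
        rw [← lintegral_sub_left_eq_self a t]
        exact sq_lintegral_mul_le (by fun_prop) hb.aemeasurable
    _ = (∫⁻ s, a s ∂μ) * ∫⁻ s, ∫⁻ t, a (t - s) * b s ^ 2 ∂μ ∂μ := by
        rw [lintegral_const_mul _ hm.lintegral_prod_right',
          lintegral_lintegral_swap hm.aemeasurable]
    _ = (∫⁻ s, a s ∂μ) * ∫⁻ s, (∫⁻ t, a t ∂μ) * b s ^ 2 ∂μ := by
        congr! 3 with s
        rw [lintegral_mul_const _ (by fun_prop), lintegral_sub_right_eq_self a s]
    _ = _ := by rw [lintegral_const_mul _ (by fun_prop)]; ring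

theorem eLpNorm_two_sq {α E : Type*} [MeasurableSpace α] [NormedAddCommGroup E] (f : α → E)
    (μ : Measure α) : eLpNorm f 2 μ ^ 2 = ∫⁻ t, ‖f t‖ₑ ^ 2 ∂μ := by
  simpa using eLpNorm_nnreal_pow_eq_lintegral (f := f) (μ := μ) (p := 2) (by norm_num)

theorem eLpNorm_two_le_of_enorm_le_lconv {E F : Type*} [NormedAddCommGroup E]
    [NormedAddCommGroup F] [MeasurableSpace E] [OpensMeasurableSpace E] {a : G → ℝ≥0∞} {v : G → E}
    {g : G → F} (ha : Measurable a) (hv : Measurable v)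
    (hg : ∀ t, ‖g t‖ₑ ≤ ∫⁻ s, a (t - s) * ‖v s‖ₑ ∂μ) :
    eLpNorm g 2 μ ≤ (∫⁻ t, a t ∂μ) * eLpNorm v 2 μ := by
  rw [← ENNReal.pow_le_pow_left_iff (n := 2) two_ne_zero, mul_pow, eLpNorm_two_sq, eLpNorm_two_sq]
  exact (lintegral_mono fun t => pow_le_pow_left' (hg t) 2).trans
    (lintegral_sq_lconv_le ha hv.enorm)

end Young

section Coercivity

variable {E : Type*} [NormedAddCommGroup E] [InnerProductSpace ℝ E] [FiniteDimensional ℝ E]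
  [MeasurableSpace E] [BorelSpace E] {h v : E → ℂ}

theorem conv_eq_convolution (h v : E → ℂ) :
    (fun t => ∫ s, h (t - s) * v s) = v ⋆[mul ℂ ℂ] h := by
  ext t
  simp only [convolution, mul_apply', mul_comm]

theorem memLp_two_conv (hhm : Measurable h) (hvm : Measurable v) (hh : Integrable h)
    (hv1 : Integrable v) (hv2 : MemLp v 2) : MemLp (fun t => ∫ s, h (t - s) * v s) 2 := by
  refine ⟨?_, (eLpNorm_two_le_of_enorm_le_lconv (μ := volume) hhm.enorm hvm fun t => ?_).trans_lt
    (ENNReal.mul_lt_top hh.2 hv2.2)⟩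
  · rw [conv_eq_convolution]
    exact (hv1.integrable_convolution _ hh).aestronglyMeasurable
  · simpa only [enorm_mul] using enorm_integral_le_lintegral_enorm fun s => h (t - s) * v s

theorem fourier_sub_conv (hh : Integrable h) (hv : Integrable v) (ξ : E) :
    𝓕 (fun t => v t - ∫ s, h (t - s) * v s) ξ = (1 - 𝓕 h ξ) * 𝓕 v ξ := by
  have hconv : Integrable fun t => ∫ s, h (t - s) * v s := by
    rw [conv_eq_convolution]
    exact hv.integrable_convolution _ hh
  have hsub : 𝓕 (fun t => v t - ∫ s, h (t - s) * v s) ξ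
      = 𝓕 v ξ - 𝓕 (fun t => ∫ s, h (t - s) * v s) ξ := by
    simp only [Real.fourier_eq, smul_sub]
    exact integral_sub ((Real.fourierIntegral_convergent_iff ξ).2 hv)
      ((Real.fourierIntegral_convergent_iff ξ).2 hconv)
  rw [hsub, conv_eq_convolution, Real.fourier_mul_convolution_eq hv hh]
  ring

theorem eLpNorm_two_le_of_le_norm_one_sub_fourier (hhm : Measurable h) (hvm : Measurable v)
    (hh : Integrable h) (hv1 : Integrable v) (hv2 : MemLp v 2) {κ : ℝ}
    (hκ : 0 ≤ κ) (hs : ∀ ξ, κ ≤ ‖1 - 𝓕 h ξ‖) :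
    ENNReal.ofReal κ * eLpNorm v 2 volume ≤
      eLpNorm (fun t => v t - ∫ s, h (t - s) * v s) 2 volume := by
  have hc1 : Integrable fun t => ∫ s, h (t - s) * v s := by
    rw [conv_eq_convolution]
    exact hv1.integrable_convolution _ hh
  have hPlancherel := eLpNorm_fourier_two (hv1.sub hc1)
    (hv2.sub (memLp_two_conv hhm hvm hh hv1 hv2))
  simp only [Pi.sub_def] at hPlancherel
  rw [← eLpNorm_fourier_two hv1 hv2, ← hPlancherel]
  calc ENNReal.ofReal κ * eLpNorm (𝓕 v) 2 volume
      = eLpNorm ((κ : ℂ) • 𝓕 v) 2 volume := by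
        rw [eLpNorm_const_smul, ← ofReal_norm, Complex.norm_of_nonneg hκ]
    _ ≤ _ := eLpNorm_mono fun ξ => by
        rw [fourier_sub_conv hh hv1, norm_mul, Pi.smul_apply, norm_smul]
        rw [Complex.norm_of_nonneg hκ]
        gcongr
        exact hs ξ

end Coercivity

section Gronwall

theorem integral_le_integral_exp_mul_of_le_add_mul_integral {φ g : ℝ → ℝ} {M : ℝ}
    (hφ : ContinuousOn φ (Ici 0)) (hg : ∀ t, 0 ≤ t → IntegrableOn g (Icc 0 t))
    (hle : ∀ t, 0 < t → φ t ≤ g t + M * ∫ s in (0 : ℝ)..t, φ s) {t : ℝ} (ht : 0 ≤ t) :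
    ∫ s in (0 : ℝ)..t, φ s ≤ ∫ s in (0 : ℝ)..t, Real.exp (M * (t - s)) * g s := by
  have hint (s : ℝ) (hs : 0 ≤ s) : IntervalIntegrable φ volume 0 s :=
    (hφ.mono (by rw [uIcc_of_le hs]; exact Icc_subset_Ici_self)).intervalIntegrable
  have hcont : ContinuousOn (fun s => Real.exp (-M * s) * ∫ r in (0 : ℝ)..s, φ r) (Icc 0 t) :=
    (by fun_prop : Continuous fun s => Real.exp (-M * s)).continuousOn.mul <| by
      simpa [uIcc_of_le ht] using intervalIntegral.continuousOn_primitive_interval'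
        (hint t ht) left_mem_uIcc
  have hderiv (s : ℝ) (hs : s ∈ Ioo 0 t) :
      HasDerivAt (fun s => Real.exp (-M * s) * ∫ r in (0 : ℝ)..s, φ r)
        (Real.exp (-M * s) * (φ s - M * ∫ r in (0 : ℝ)..s, φ r)) s := by
    have hφs := hφ.continuousAt (Ici_mem_nhds hs.1)
    have hF := intervalIntegral.integral_hasDerivAt_right (hint s hs.1.le)
      (hφ.mono Ioi_subset_Ici_self |>.stronglyMeasurableAtFilter isOpen_Ioi s hs.1) hφs
    have hE : HasDerivAt (fun s : ℝ => Real.exp (-M * s)) (Real.exp (-M * s) * -M) s := by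
      simpa using ((hasDerivAt_id s).const_mul (-M)).exp
    exact (hE.mul hF).congr_deriv (by ring)
  have hmain : Real.exp (-M * t) * ∫ s in (0 : ℝ)..t, φ s
      ≤ ∫ s in (0 : ℝ)..t, Real.exp (-M * s) * g s := by
    have := intervalIntegral.sub_le_integral_of_hasDeriv_right_of_le ht hcont
      (fun s hs => (hderiv s hs).hasDerivWithinAt)
      ((hg t ht).continuousOn_mul (by fun_prop : Continuous fun s : ℝ =>
        Real.exp (-M * s)).continuousOn isCompact_Icc) fun s hs => by
        gcongr
        linarith [hle s hs.1]
    simpa using this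
  calc ∫ s in (0 : ℝ)..t, φ s
      = Real.exp (M * t) * (Real.exp (-M * t) * ∫ s in (0 : ℝ)..t, φ s) := by
        rw [← mul_assoc, ← Real.exp_add]; simp
    _ ≤ Real.exp (M * t) * ∫ s in (0 : ℝ)..t, Real.exp (-M * s) * g s := by gcongr
    _ = _ := by
        rw [← intervalIntegral.integral_const_mul]
        congr! 2 with _
        rw [← mul_assoc, ← Real.exp_add]
        ring_nf

variable {h u f : ℝ → ℂ} {M : ℝ}

theorem norm_le_add_mul_integral_of_volterra (hu : ContinuousOn u (Ici 0)) (hM : ∀ t, ‖h t‖ ≤ M)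
    (heq : ∀ t, 0 < t → u t = f t + ∫ s in (0 : ℝ)..t, h (t - s) * u s) (t : ℝ) (ht : 0 < t) :
    ‖u t‖ ≤ ‖f t‖ + M * ∫ s in (0 : ℝ)..t, ‖u s‖ := by
  have hint : IntervalIntegrable (fun s => ‖u s‖) volume 0 t :=
    (hu.norm.mono (by rw [uIcc_of_le ht.le]; exact Icc_subset_Ici_self)).intervalIntegrable
  have hconv : ‖∫ s in (0 : ℝ)..t, h (t - s) * u s‖ ≤ M * ∫ s in (0 : ℝ)..t, ‖u s‖ := by
    rw [← intervalIntegral.integral_const_mul]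
    refine intervalIntegral.norm_integral_le_of_norm_le ht.le
      (Eventually.of_forall fun s _ => ?_) (hint.const_mul M)
    rw [norm_mul]
    gcongr
    exact hM _
  calc ‖u t‖ = ‖f t + ∫ s in (0 : ℝ)..t, h (t - s) * u s‖ := congrArg _ (heq t ht)
    _ ≤ _ := (norm_add_le _ _).trans (by gcongr)

theorem memLp_two_exp_neg_Ioi {ε : ℝ} (hε : 0 < ε) :
    MemLp (fun t => Real.exp (-ε * t)) 2 (volume.restrict (Ioi 0)) := by
  rw [memLp_two_iff_integrable_sq
    (by fun_prop : Continuous fun t => Real.exp (-ε * t)).aestronglyMeasurable]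
  simpa [← Real.exp_nat_mul, mul_assoc, IntegrableOn] using
    integrableOn_exp_mul_Ioi (by linarith : 2 * -ε < 0) 0

theorem exists_norm_le_add_mul_exp_of_volterra (hu : ContinuousOn u (Ici 0))
    (hM0 : 0 < M) (hM : ∀ t, ‖h t‖ ≤ M) (hf : MemLp f 2 (volume.restrict (Ioi 0)))
    (heq : ∀ t, 0 < t → u t = f t + ∫ s in (0 : ℝ)..t, h (t - s) * u s) :
    ∃ C, ∀ t, 0 < t → ‖u t‖ ≤ ‖f t‖ + C * Real.exp (M * t) := by
  have hexp : IntegrableOn (fun s => Real.exp (-M * s) * ‖f s‖) (Ioi 0) :=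
    (memLp_two_exp_neg_Ioi hM0).integrable_mul hf.norm
  refine ⟨M * ∫ s in Ioi 0, Real.exp (-M * s) * ‖f s‖, fun t ht => ?_⟩
  refine (norm_le_add_mul_integral_of_volterra hu hM heq t ht).trans ?_
  rw [mul_assoc]
  gcongr
  calc ∫ s in (0 : ℝ)..t, ‖u s‖
      ≤ ∫ s in (0 : ℝ)..t, Real.exp (M * (t - s)) * ‖f s‖ :=
        integral_le_integral_exp_mul_of_le_add_mul_integral hu.norm
          (fun t _ => (integrableOn_Icc_iff_integrableOn_Ioc).2 <| MemLp.integrable one_le_two <|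
            hf.norm.mono_measure (Measure.restrict_mono Ioc_subset_Ioi_self le_rfl))
          (norm_le_add_mul_integral_of_volterra hu hM heq) ht.le
    _ = ∫ s in Ioc 0 t, (Real.exp (-M * s) * ‖f s‖) * Real.exp (M * t) := by
        rw [intervalIntegral.integral_of_le ht.le]
        congr! 2 with _
        rw [mul_right_comm, ← Real.exp_add]
        ring_nf
    _ ≤ (∫ s in Ioi 0, Real.exp (-M * s) * ‖f s‖) * Real.exp (M * t) := by
        rw [integral_mul_const]
        gcongr ?_ * _
        exact setIntegral_mono_set hexp (Eventually.of_forall fun s => by positivity)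
          Ioc_subset_Ioi_self.eventuallyLE

theorem eqOn_of_volterra {v : ℝ → ℂ} (hh : Continuous h) (hM : ∀ t, ‖h t‖ ≤ M)
    (hu : ContinuousOn u (Ici 0)) (hv : ContinuousOn v (Ici 0))
    (hequ : ∀ t, 0 < t → u t = f t + ∫ s in (0 : ℝ)..t, h (t - s) * u s)
    (heqv : ∀ t, 0 < t → v t = f t + ∫ s in (0 : ℝ)..t, h (t - s) * v s) :
    EqOn u v (Ioi 0) := by
  intro t ht
  have hint (w : ℝ → ℂ) (hw : ContinuousOn w (Ici 0)) (t : ℝ) (ht : 0 < t) :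
      IntervalIntegrable (fun s => h (t - s) * w s) volume 0 t := by
    refine ContinuousOn.intervalIntegrable ?_
    rw [uIcc_of_le ht.le]
    exact (by fun_prop : Continuous fun s => h (t - s)).continuousOn.mul
      (hw.mono Icc_subset_Ici_self)
  have heq (t : ℝ) (ht : 0 < t) :
      (u - v) t = (0 : ℝ → ℂ) t + ∫ s in (0 : ℝ)..t, h (t - s) * (u - v) s := by
    simp only [Pi.sub_apply, mul_sub, Pi.zero_apply, zero_add]
    rw [intervalIntegral.integral_sub (hint u hu t ht) (hint v hv t ht)]
    linear_combination hequ t ht - heqv t ht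
  have hle := norm_le_add_mul_integral_of_volterra (hu.sub hv) hM heq
  have hzero : ∫ s in (0 : ℝ)..t, ‖(u - v) s‖ ≤ 0 := by
    simpa using integral_le_integral_exp_mul_of_le_add_mul_integral (hu.sub hv).norm (by simp)
      hle (le_of_lt ht)
  have hM0 : 0 ≤ M := (norm_nonneg _).trans (hM 0)
  refine sub_eq_zero.1 (norm_le_zero_iff.1 ((hle t ht).trans ?_))
  simpa using mul_nonpos_of_nonneg_of_nonpos hM0 hzero

end Gronwall

section CausalVolterra

/-- Functions of time supported in `(0, ∞)`. -/
def Causal (v : ℝ → ℂ) : Prop := ∀ t ≤ 0, v t = 0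

theorem causal_indicator_Ioi (v : ℝ → ℂ) : Causal ((Ioi 0).indicator v) :=
  fun _ ht => indicator_of_notMem (notMem_Ioi.2 ht) v

theorem Causal.norm_exp_mul_le {v : ℝ → ℂ} (hv : Causal v) {a b : ℝ} (hab : a ≤ b) (t : ℝ) :
    ‖(Real.exp (-b * t) : ℂ) * v t‖ ≤ ‖(Real.exp (-a * t) : ℂ) * v t‖ := by
  rcases le_or_gt t 0 with ht | ht
  · simp [hv t ht]
  · simp only [norm_mul, Complex.norm_real, Real.norm_eq_abs, Real.abs_exp]
    gcongr

theorem Causal.integrable_exp_mul {v : ℝ → ℂ} (hv : Causal v) (hvm : Measurable v)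
    (hint : Integrable v) {τ : ℝ} (hτ : 0 ≤ τ) :
    Integrable fun t : ℝ => (Real.exp (-τ * t) : ℂ) * v t :=
  hint.mono (by fun_prop : Measurable _).aestronglyMeasurable
    (Eventually.of_forall fun t => by simpa using hv.norm_exp_mul_le hτ t)

theorem Causal.integrable_exp_mul_of_memLp_two {v : ℝ → ℂ} (hv : Causal v) {ε : ℝ} (hε : 0 < ε)
    (h2 : MemLp v 2) : Integrable fun t : ℝ => (Real.exp (-ε * t) : ℂ) * v t := by
  have hE : MemLp ((Ioi 0).indicator fun t : ℝ => (Real.exp (-ε * t) : ℂ)) 2 :=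
    (memLp_indicator_iff_restrict measurableSet_Ioi).2 (memLp_two_exp_neg_Ioi hε).ofReal
  refine (hE.integrable_mul h2).congr (Eventually.of_forall fun t => ?_)
  rcases le_or_gt t 0 with ht | ht
  · simp [hv t ht]
  · simp [indicator_of_mem (mem_Ioi.2 ht)]

theorem Causal.memLp_two_exp_mul_of_norm_le {u f : ℝ → ℂ} (hu : Causal u) (hum : Measurable u)
    (hf : MemLp f 2) {C b τ : ℝ} (hle : ∀ t, 0 < t → ‖u t‖ ≤ ‖f t‖ + C * Real.exp (b * t))
    (hτ : 0 ≤ τ) (hbτ : b < τ) : MemLp (fun t : ℝ => (Real.exp (-τ * t) : ℂ) * u t) 2 := by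
  have hE : MemLp ((Ioi 0).indicator fun t : ℝ => C * Real.exp (-(τ - b) * t)) 2 :=
    (memLp_indicator_iff_restrict measurableSet_Ioi).2
      ((memLp_two_exp_neg_Ioi (sub_pos.2 hbτ)).const_mul C)
  refine (hf.norm.add hE).mono (by fun_prop : Measurable _).aestronglyMeasurable
    (Eventually.of_forall fun t => (le_trans ?_ (le_abs_self _)))
  rcases le_or_gt t 0 with ht | ht
  · simp [hu t ht, indicator_of_notMem (notMem_Ioi.2 ht)]
  rw [norm_mul, Complex.norm_real, Real.norm_eq_abs, Real.abs_exp, Pi.add_apply,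
    indicator_of_mem (mem_Ioi.2 ht)]
  calc Real.exp (-τ * t) * ‖u t‖ ≤ Real.exp (-τ * t) * (‖f t‖ + C * Real.exp (b * t)) := by
        gcongr; exact hle t ht
    _ = Real.exp (-τ * t) * ‖f t‖ + C * Real.exp (-(τ - b) * t) := by
        rw [mul_add, mul_left_comm, ← Real.exp_add]; ring_nf
    _ ≤ 1 * ‖f t‖ + C * Real.exp (-(τ - b) * t) := by
        gcongr
        exact Real.exp_le_one_iff.2 (by nlinarith)
    _ = _ := by rw [one_mul]

/-- A weight on `(0, ∞)` that is slowly varying relative to `e^{-τ t}`: its conjugation defect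
`m(t) - e^{-τ (t - s)} m(s)`, which vanishes for `m(t) = e^{-τ t}`, is controlled by `t - s`. -/
structure SlowWeight (τ c : ℝ) (m : ℝ → ℝ) : Prop where
  measurable : Measurable m
  nonneg : ∀ {t}, 0 < t → 0 ≤ m t
  le_one : ∀ {t}, 0 < t → m t ≤ 1
  abs_sub_le : ∀ {s t}, 0 < s → s < t →
    |m t - Real.exp (-τ * (t - s)) * m s| ≤ c * (t - s) * m s

theorem SlowWeight.norm_mul_le {τ c : ℝ} {m : ℝ → ℝ} (hm : SlowWeight τ c m) {v : ℝ → ℂ}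
    (hv : Causal v) (t : ℝ) : ‖(m t : ℂ) * v t‖ ≤ ‖v t‖ := by
  rcases le_or_gt t 0 with ht | ht
  · simp [hv t ht]
  · rw [norm_mul, Complex.norm_of_nonneg (hm.nonneg ht)]
    exact mul_le_of_le_one_left (norm_nonneg _) (hm.le_one ht)

theorem slowWeight_exp {τ : ℝ} (hτ : 0 ≤ τ) : SlowWeight τ 0 fun t => Real.exp (-τ * t) where
  measurable := by fun_prop
  nonneg _ := (Real.exp_pos _).le
  le_one ht := Real.exp_le_one_iff.2 (by nlinarith)
  abs_sub_le _ _ := by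
    rw [← Real.exp_add]
    ring_nf
    simp

/-- The weight `e^{-τ t} min(e^{ρ t}, e^{ρ R})`, which equals `e^{-(τ - ρ) t}` up to time `R` and
decays like `e^{-τ t}` afterwards. -/
noncomputable def truncWeight (τ ρ R t : ℝ) : ℝ :=
  Real.exp (-τ * t) * min (Real.exp (ρ * t)) (Real.exp (ρ * R))

theorem truncWeight_nonneg (τ ρ R t : ℝ) : 0 ≤ truncWeight τ ρ R t := by
  unfold truncWeight; positivity

theorem truncWeight_of_le {τ ρ R t : ℝ} (hρ : 0 ≤ ρ) (ht : t ≤ R) :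
    truncWeight τ ρ R t = Real.exp (-(τ - ρ) * t) := by
  rw [truncWeight, min_eq_left (Real.exp_le_exp.2 (by gcongr)), ← Real.exp_add]
  ring_nf

theorem truncWeight_le_mul_exp (τ ρ R t : ℝ) :
    truncWeight τ ρ R t ≤ Real.exp (ρ * R) * Real.exp (-τ * t) := by
  rw [truncWeight, mul_comm]
  gcongr
  exact min_le_right _ _

theorem truncWeight_le_exp (τ ρ R t : ℝ) : truncWeight τ ρ R t ≤ Real.exp (-(τ - ρ) * t) :=
  calc truncWeight τ ρ R t ≤ Real.exp (-τ * t) * Real.exp (ρ * t) := by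
        rw [truncWeight]; gcongr; exact min_le_left _ _
    _ = _ := by rw [← Real.exp_add]; ring_nf

theorem exp_neg_mul_sub_le {τ ρ δ a b : ℝ} (hρ : 0 ≤ ρ) (hτ : ρ ≤ τ) (hδ : 0 ≤ δ) (ha : 0 ≤ a)
    (hba : b ≤ Real.exp (ρ * δ) * a) : Real.exp (-τ * δ) * (b - a) ≤ ρ * δ * a := by
  have hexp : 0 ≤ Real.exp (ρ * δ) - 1 := sub_nonneg.2 (Real.one_le_exp (by positivity))
  have hcancel : Real.exp (-ρ * δ) * Real.exp (ρ * δ) = 1 := by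
    rw [← Real.exp_add]; simp
  calc Real.exp (-τ * δ) * (b - a)
      ≤ Real.exp (-τ * δ) * ((Real.exp (ρ * δ) - 1) * a) := by gcongr; linarith
    _ ≤ Real.exp (-ρ * δ) * ((Real.exp (ρ * δ) - 1) * a) := by gcongr
    _ = (1 - Real.exp (-ρ * δ)) * a := by linear_combination a * hcancel
    _ ≤ ρ * δ * a := by
        gcongr
        linarith [Real.add_one_le_exp (-ρ * δ)]

theorem abs_truncWeight_sub_le {τ ρ R s t : ℝ} (hρ : 0 ≤ ρ) (hτ : ρ ≤ τ) (hst : s ≤ t) :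
    |truncWeight τ ρ R t - Real.exp (-τ * (t - s)) * truncWeight τ ρ R s|
      ≤ ρ * (t - s) * truncWeight τ ρ R s := by
  set a := min (Real.exp (ρ * s)) (Real.exp (ρ * R)) with ha
  set b := min (Real.exp (ρ * t)) (Real.exp (ρ * R)) with hb
  have hab : a ≤ b := min_le_min_right _ (Real.exp_le_exp.2 (by gcongr))
  have hba : b ≤ Real.exp (ρ * (t - s)) * a := by
    rw [ha, mul_min_of_nonneg _ _ (Real.exp_pos _).le, ← Real.exp_add, ← Real.exp_add]
    exact min_le_min (Real.exp_le_exp.2 (by linarith)) (Real.exp_le_exp.2 (by nlinarith))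
  have hexp : Real.exp (-τ * t) = Real.exp (-τ * s) * Real.exp (-τ * (t - s)) := by
    rw [← Real.exp_add]; ring_nf
  have hdefect : truncWeight τ ρ R t - Real.exp (-τ * (t - s)) * truncWeight τ ρ R s
      = Real.exp (-τ * s) * (Real.exp (-τ * (t - s)) * (b - a)) := by
    simp only [truncWeight, ← ha, ← hb, hexp]
    ring
  rw [hdefect, abs_of_nonneg (by have := sub_nonneg.2 hab; positivity)]
  calc _ ≤ Real.exp (-τ * s) * (ρ * (t - s) * a) := by
        gcongr _ * ?_
        exact exp_neg_mul_sub_le hρ hτ (sub_nonneg.2 hst) (by positivity) hba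
    _ = ρ * (t - s) * truncWeight τ ρ R s := by rw [truncWeight, ← ha]; ring

theorem slowWeight_truncWeight {τ ρ : ℝ} (hρ : 0 ≤ ρ) (hτ : ρ ≤ τ) (R : ℝ) :
    SlowWeight τ ρ (truncWeight τ ρ R) where
  measurable := by unfold truncWeight; fun_prop
  nonneg _ := truncWeight_nonneg τ ρ R _
  le_one ht := (truncWeight_le_exp τ ρ R _).trans (Real.exp_le_one_iff.2 (by nlinarith))
  abs_sub_le _ hst := abs_truncWeight_sub_le hρ hτ hst.le

/-- The Volterra equation `u = f + h * u` for functions supported in `(0, ∞)`, with `h` integrable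
and `u` locally bounded. -/
structure CausalVolterra (h u f : ℝ → ℂ) : Prop where
  measurable_kernel : Measurable h
  measurable_sol : Measurable u
  measurable_source : Measurable f
  causal_kernel : Causal h
  causal_sol : Causal u
  causal_source : Causal f
  integrable_kernel : Integrable h
  bounded_sol : ∀ T, ∃ B, ∀ t ≤ T, ‖u t‖ ≤ B
  eq : ∀ t, u t = f t + ∫ s, h (t - s) * u s

theorem eLpNorm_two_le_of_tendsto {α E : Type*} [MeasurableSpace α] {μ : Measure α}
    [NormedAddCommGroup E] {v : ℕ → α → E} {u : α → E} (hv : ∀ n, AEStronglyMeasurable (v n) μ)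
    (hlim : ∀ t, Tendsto (fun n => v n t) atTop (𝓝 (u t))) {p C : ℝ≥0∞}
    (hC : ∀ n, eLpNorm (v n) p μ ≤ C) : eLpNorm u p μ ≤ C :=
  (Lp.eLpNorm_lim_le_liminf_eLpNorm hv u (Eventually.of_forall hlim)).trans <|
    liminf_le_of_le (by isBoundedDefault) fun _ hb =>
      let ⟨n, hn⟩ := hb.exists
      hn.trans (hC n)

theorem le_ofReal_two_div_mul_of_le_add {κ : ℝ} (hκ : 0 < κ) {a b : ℝ≥0∞} (ha : a ≠ ∞)
    (h : ENNReal.ofReal κ * a ≤ b + ENNReal.ofReal (κ / 2) * a) :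
    a ≤ ENNReal.ofReal (2 / κ) * b := by
  have hhalf : a * ENNReal.ofReal (κ / 2) ≤ b := by
    rw [← add_halves κ, ENNReal.ofReal_add (by positivity) (by positivity), add_mul,
      add_halves] at h
    rw [mul_comm]
    exact (ENNReal.add_le_add_iff_right (ENNReal.mul_ne_top ENNReal.ofReal_ne_top ha)).1 h
  rw [← inv_div, ENNReal.ofReal_inv_of_pos (half_pos hκ), ← ENNReal.div_eq_inv_mul]
  exact (ENNReal.le_div_iff_mul_le (by simp [hκ]) (by simp)).2 hhalf

theorem exists_pos_ofReal_mul_le {I : ℝ≥0∞} (hI : I ≠ ∞) {ε : ℝ} (hε : 0 < ε) :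
    ∃ ρ : ℝ, 0 < ρ ∧ ENNReal.ofReal ρ * I ≤ ENNReal.ofReal ε := by
  refine ⟨ε / (I.toReal + 1), by positivity, ?_⟩
  rw [← ENNReal.ofReal_toReal hI, ← ENNReal.ofReal_mul (by positivity),
    ENNReal.toReal_ofReal ENNReal.toReal_nonneg]
  refine ENNReal.ofReal_le_ofReal ?_
  rw [div_mul_eq_mul_div, div_le_iff₀ (by positivity)]
  gcongr
  linarith

namespace CausalVolterra

variable {h u f : ℝ → ℂ}

theorem integrable_conv (hV : CausalVolterra h u f) (t : ℝ) :
    Integrable fun s => h (t - s) * u s := by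
  obtain ⟨B, hB⟩ := hV.bounded_sol t
  have hh := hV.integrable_kernel.comp_sub_left t
  refine (hh.norm.mul_const B).mono'
    (hh.aestronglyMeasurable.mul hV.measurable_sol.aestronglyMeasurable)
    (Eventually.of_forall fun s => ?_)
  rw [norm_mul]
  rcases le_or_gt s t with hs | hs
  · gcongr; exact hB s hs
  · simp [hV.causal_kernel (t - s) (by linarith)]

theorem weighted_eq (hV : CausalVolterra h u f) {m : ℝ → ℝ} {τ c : ℝ}
    (hm : SlowWeight τ c m) (hτ : 0 ≤ τ) (t : ℝ) :
    (m t : ℂ) * u t - ∫ s, ((Real.exp (-τ * (t - s)) : ℂ) * h (t - s)) * ((m s : ℂ) * u s)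
      = m t * f t + ∫ s, ((m t : ℂ) - Real.exp (-τ * (t - s)) * m s) * (h (t - s) * u s) := by
  have hu := hV.measurable_sol
  have hh := hV.measurable_kernel
  have hmm := hm.measurable
  have hint := hV.integrable_conv t
  have hint' : Integrable fun s =>
      ((Real.exp (-τ * (t - s)) : ℂ) * h (t - s)) * ((m s : ℂ) * u s) := by
    refine hint.mono (by fun_prop : Measurable _).aestronglyMeasurable
      (Eventually.of_forall fun s => ?_)
    rw [norm_mul, norm_mul (h (t - s))]
    gcongr
    · simpa using hV.causal_kernel.norm_exp_mul_le hτ (t - s)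
    · exact hm.norm_mul_le hV.causal_sol s
  have hsplit : ∫ s, ((m t : ℂ) - Real.exp (-τ * (t - s)) * m s) * (h (t - s) * u s)
      = m t * (∫ s, h (t - s) * u s) -
        ∫ s, ((Real.exp (-τ * (t - s)) : ℂ) * h (t - s)) * ((m s : ℂ) * u s) := by
    rw [← integral_const_mul, ← integral_sub (hint.const_mul _) hint']
    congr 1; ext s; ring
  rw [hsplit]
  linear_combination (m t : ℂ) * hV.eq t

theorem enorm_commutator_le (hV : CausalVolterra h u f) {m : ℝ → ℝ} {τ c : ℝ}
    (hm : SlowWeight τ c m) (hc : 0 ≤ c) (t : ℝ) :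
    ‖∫ s, ((m t : ℂ) - Real.exp (-τ * (t - s)) * m s) * (h (t - s) * u s)‖ₑ
      ≤ ∫⁻ s, ENNReal.ofReal c * ‖((t - s : ℝ) : ℂ) * h (t - s)‖ₑ * ‖(m s : ℂ) * u s‖ₑ := by
  refine (enorm_integral_le_lintegral_enorm _).trans (lintegral_mono fun s => ?_)
  rcases le_or_gt s 0 with hs | hs
  · simp [hV.causal_sol s hs]
  rcases le_or_gt (t - s) 0 with hts | hts
  · simp [hV.causal_kernel _ hts]
  have hcomm : ‖(m t : ℂ) - Real.exp (-τ * (t - s)) * m s‖ ≤ c * (t - s) * m s := by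
    rw [← Complex.ofReal_mul, ← Complex.ofReal_sub, Complex.norm_real]
    exact hm.abs_sub_le hs (sub_pos.1 hts)
  have hc' : ENNReal.ofReal c = ‖(c : ℂ)‖ₑ := by
    rw [← ofReal_norm, Complex.norm_of_nonneg hc]
  rw [hc', ← enorm_mul, ← enorm_mul, enorm_le_iff_norm_le]
  simp only [norm_mul, Complex.norm_of_nonneg hc, Complex.norm_of_nonneg (hm.nonneg hs),
    Complex.norm_of_nonneg hts.le]
  calc _ ≤ c * (t - s) * m s * (‖h (t - s)‖ * ‖u s‖) := by gcongr
    _ = _ := by ring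

theorem eLpNorm_weighted_le (hV : CausalVolterra h u f) {κ τ c : ℝ} (hκ : 0 ≤ κ)
    (hs : ∀ y, κ ≤ ‖1 - 𝓕 (fun t : ℝ => (Real.exp (-τ * t) : ℂ) * h t) y‖)
    {m : ℝ → ℝ} (hm : SlowWeight τ c m) (hτ : 0 ≤ τ) (hc : 0 ≤ c)
    (h1 : Integrable fun t => (m t : ℂ) * u t) (h2 : MemLp (fun t => (m t : ℂ) * u t) 2) :
    ENNReal.ofReal κ * eLpNorm (fun t => (m t : ℂ) * u t) 2 volume ≤ eLpNorm f 2 volume +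
      ENNReal.ofReal c * (∫⁻ t : ℝ, ‖(t : ℂ) * h t‖ₑ) *
        eLpNorm (fun t => (m t : ℂ) * u t) 2 volume := by
  have hu := hV.measurable_sol
  have hh := hV.measurable_kernel
  have hf := hV.measurable_source
  have hmm := hm.measurable
  have hmu : Measurable fun t => (m t : ℂ) * u t := by fun_prop
  have hcoercive := eLpNorm_two_le_of_le_norm_one_sub_fourier
    (h := fun t : ℝ => (Real.exp (-τ * t) : ℂ) * h t) (by fun_prop) hmu
    (hV.causal_kernel.integrable_exp_mul hh hV.integrable_kernel hτ) h1 h2 hκ hs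
  simp only [hV.weighted_eq hm hτ] at hcoercive
  have hE : StronglyMeasurable fun z : ℝ × ℝ =>
      ((m z.1 : ℂ) - Real.exp (-τ * (z.1 - z.2)) * m z.2) * (h (z.1 - z.2) * u z.2) :=
    (by fun_prop : Measurable _).stronglyMeasurable
  refine (hcoercive.trans (eLpNorm_add_le (by fun_prop : Measurable _).aestronglyMeasurable
    hE.integral_prod_right'.aestronglyMeasurable one_le_two)).trans (add_le_add ?_ ?_)
  · exact eLpNorm_mono fun t => hm.norm_mul_le hV.causal_source t
  · rw [← lintegral_const_mul _ (by fun_prop)]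
    exact eLpNorm_two_le_of_enorm_le_lconv
      (a := fun r : ℝ => ENNReal.ofReal c * ‖(r : ℂ) * h r‖ₑ) (by fun_prop) hmu
      (hV.enorm_commutator_le hm hc)

theorem eLpNorm_truncWeight_le (hV : CausalVolterra h u f) {κ : ℝ} (hκ : 0 < κ) {ρ τ : ℝ}
    (hρ : 0 ≤ ρ) (hτ : ρ ≤ τ)
    (hs : ∀ y, κ ≤ ‖1 - 𝓕 (fun t : ℝ => (Real.exp (-τ * t) : ℂ) * h t) y‖)
    (hsmall : ENNReal.ofReal ρ * ∫⁻ t : ℝ, ‖(t : ℂ) * h t‖ₑ ≤ ENNReal.ofReal (κ / 2))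
    (h1 : Integrable fun t : ℝ => (Real.exp (-τ * t) : ℂ) * u t)
    (h2 : MemLp (fun t : ℝ => (Real.exp (-τ * t) : ℂ) * u t) 2) (R : ℝ) :
    eLpNorm (fun t => (truncWeight τ ρ R t : ℂ) * u t) 2 volume
      ≤ ENNReal.ofReal (2 / κ) * eLpNorm f 2 volume := by
  have hm := slowWeight_truncWeight hρ hτ R
  have hu := hV.measurable_sol
  have hmm := hm.measurable
  have hmeas : AEStronglyMeasurable (fun t => (truncWeight τ ρ R t : ℂ) * u t) volume :=
    (by fun_prop : Measurable _).aestronglyMeasurable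
  have hdom (t : ℝ) : ‖(truncWeight τ ρ R t : ℂ) * u t‖
      ≤ ‖(Real.exp (ρ * R) : ℂ) * ((Real.exp (-τ * t) : ℂ) * u t)‖ := by
    simp only [norm_mul, Complex.norm_real, Real.norm_eq_abs, Real.abs_exp, ← mul_assoc,
      abs_of_nonneg (truncWeight_nonneg τ ρ R t)]
    gcongr
    exact truncWeight_le_mul_exp τ ρ R t
  have hv2 := (h2.const_mul (Real.exp (ρ * R) : ℂ)).mono hmeas (Eventually.of_forall hdom)
  refine le_ofReal_two_div_mul_of_le_add hκ hv2.2.ne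
    ((hV.eLpNorm_weighted_le hκ.le hs hm (hρ.trans hτ) hρ
      ((h1.const_mul _).mono hmeas (Eventually.of_forall hdom)) hv2).trans ?_)
  gcongr

theorem memLp_exp_mul_sub (hV : CausalVolterra h u f) {κ : ℝ} (hκ : 0 < κ) {ρ τ : ℝ}
    (hρ : 0 ≤ ρ) (hτ : ρ ≤ τ)
    (hs : ∀ y, κ ≤ ‖1 - 𝓕 (fun t : ℝ => (Real.exp (-τ * t) : ℂ) * h t) y‖)
    (hsmall : ENNReal.ofReal ρ * ∫⁻ t : ℝ, ‖(t : ℂ) * h t‖ₑ ≤ ENNReal.ofReal (κ / 2))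
    (hf : MemLp f 2) (h1 : Integrable fun t : ℝ => (Real.exp (-τ * t) : ℂ) * u t)
    (h2 : MemLp (fun t : ℝ => (Real.exp (-τ * t) : ℂ) * u t) 2) :
    MemLp (fun t : ℝ => (Real.exp (-(τ - ρ) * t) : ℂ) * u t) 2 := by
  have hu := hV.measurable_sol
  refine ⟨(by fun_prop : Measurable _).aestronglyMeasurable, (eLpNorm_two_le_of_tendsto
    (v := fun n : ℕ => fun t => (truncWeight τ ρ n t : ℂ) * u t) (fun n => ?_) (fun t => ?_)
    fun n => hV.eLpNorm_truncWeight_le hκ hρ hτ hs hsmall h1 h2 n).trans_lt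
    (ENNReal.mul_lt_top ENNReal.ofReal_lt_top hf.2)⟩
  · have := (slowWeight_truncWeight hρ hτ n).measurable
    exact (by fun_prop : Measurable _).aestronglyMeasurable
  · refine tendsto_const_nhds.congr' ?_
    filter_upwards [eventually_ge_atTop ⌈t⌉₊] with n hn
    rw [truncWeight_of_le hρ ((Nat.le_ceil t).trans (by exact_mod_cast hn))]

/-- Starting from the exponential growth bound, each application of `memLp_exp_mul_sub` lowers the
weight by the same amount `ρ / 2`, so that weight `0` is reached after finitely many steps. -/
theorem memLp_two_sol (hV : CausalVolterra h u f) {κ : ℝ} (hκ : 0 < κ)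
    (hmom : Integrable fun t : ℝ => (t : ℂ) * h t)
    (hs : ∀ σ : ℝ, 0 < σ → ∀ y, κ ≤ ‖1 - 𝓕 (fun t : ℝ => (Real.exp (-σ * t) : ℂ) * h t) y‖)
    (hf : MemLp f 2) {C b : ℝ}
    (hgrowth : ∀ t, 0 < t → ‖u t‖ ≤ ‖f t‖ + C * Real.exp (b * t)) : MemLp u 2 := by
  have hu := hV.measurable_sol
  obtain ⟨ρ, hρ, hsmall⟩ := exists_pos_ofReal_mul_le hmom.2.ne (half_pos hκ)
  have hlower (n : ℕ) : ∀ τ : ℝ, 0 ≤ τ → b + 1 - n * (ρ / 2) ≤ τ →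
      MemLp (fun t : ℝ => (Real.exp (-τ * t) : ℂ) * u t) 2 := by
    induction n with
    | zero =>
      exact fun τ h0 hτ => hV.causal_sol.memLp_two_exp_mul_of_norm_le hu hf hgrowth h0
        (by push_cast at hτ; linarith)
    | succ n ih =>
      intro τ h0 hτ
      have hstart := ih (τ + ρ / 2) (by linarith) (by push_cast at hτ; linarith)
      have h1 : Integrable fun t : ℝ => (Real.exp (-(τ + ρ) * t) : ℂ) * u t := by
        refine (Causal.integrable_exp_mul_of_memLp_two (v := fun t : ℝ =>
          (Real.exp (-(τ + ρ / 2) * t) : ℂ) * u t) (fun t ht => by simp [hV.causal_sol t ht])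
          (half_pos hρ) hstart).congr (Eventually.of_forall fun t => ?_)
        simp only [← mul_assoc, ← Complex.ofReal_mul, ← Real.exp_add]
        ring_nf
      have h2 : MemLp (fun t : ℝ => (Real.exp (-(τ + ρ) * t) : ℂ) * u t) 2 :=
        hstart.mono (by fun_prop : Measurable _).aestronglyMeasurable (Eventually.of_forall
          (hV.causal_sol.norm_exp_mul_le (by linarith)))
      simpa using hV.memLp_exp_mul_sub hκ hρ.le (by linarith) (hs _ (by linarith)) hsmall hf h1 h2
  obtain ⟨n, hn⟩ := exists_nat_gt ((b + 1) / (ρ / 2))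
  rw [div_lt_iff₀ (by positivity)] at hn
  simpa using hlower n 0 le_rfl (by linarith)

theorem eLpNorm_exp_mul_le (hV : CausalVolterra h u f) {κ σ : ℝ} (hκ : 0 < κ) (hσ : 0 < σ)
    (hs : ∀ y, κ ≤ ‖1 - 𝓕 (fun t : ℝ => (Real.exp (-σ * t) : ℂ) * h t) y‖) (h2 : MemLp u 2) :
    eLpNorm (fun t : ℝ => (Real.exp (-σ * t) : ℂ) * u t) 2 volume
      ≤ ENNReal.ofReal (1 / κ) * eLpNorm f 2 volume := by
  have hu := hV.measurable_sol
  have h2' : MemLp (fun t : ℝ => (Real.exp (-σ * t) : ℂ) * u t) 2 :=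
    h2.mono (by fun_prop : Measurable _).aestronglyMeasurable (Eventually.of_forall fun t => by
      simpa using hV.causal_sol.norm_exp_mul_le hσ.le t)
  have hcoercive := hV.eLpNorm_weighted_le hκ.le hs (slowWeight_exp hσ.le) hσ.le le_rfl
    (hV.causal_sol.integrable_exp_mul_of_memLp_two hσ h2) h2'
  rw [ENNReal.ofReal_zero, zero_mul, zero_mul, add_zero] at hcoercive
  rw [one_div, ENNReal.ofReal_inv_of_pos hκ, ← ENNReal.div_eq_inv_mul]
  exact (ENNReal.le_div_iff_mul_le (by simp [hκ]) (by simp)).2 (by rwa [mul_comm])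

theorem eLpNorm_le (hV : CausalVolterra h u f) {κ : ℝ} (hκ : 0 < κ)
    (hmom : Integrable fun t : ℝ => (t : ℂ) * h t)
    (hs : ∀ σ : ℝ, 0 < σ → ∀ y, κ ≤ ‖1 - 𝓕 (fun t : ℝ => (Real.exp (-σ * t) : ℂ) * h t) y‖)
    (hf : MemLp f 2) {C b : ℝ}
    (hgrowth : ∀ t, 0 < t → ‖u t‖ ≤ ‖f t‖ + C * Real.exp (b * t)) :
    eLpNorm u 2 volume ≤ ENNReal.ofReal (1 / κ) * eLpNorm f 2 volume := by
  have hu := hV.measurable_sol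
  have h2 := hV.memLp_two_sol hκ hmom hs hf hgrowth
  refine eLpNorm_two_le_of_tendsto (v := fun n : ℕ => fun t : ℝ =>
    (Real.exp (-(1 / ((n : ℝ) + 1)) * t) : ℂ) * u t)
    (fun n => (by fun_prop : Measurable _).aestronglyMeasurable) (fun t => ?_)
    fun n => hV.eLpNorm_exp_mul_le hκ (by positivity) (hs _ (by positivity)) h2
  have hweight : Tendsto (fun n : ℕ => (Real.exp (-(1 / ((n : ℝ) + 1)) * t) : ℂ)) atTop
      (𝓝 (Real.exp (-0 * t) : ℂ)) :=
    (Complex.continuous_ofReal.comp Real.continuous_exp).continuousAt.tendsto.comp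
      (tendsto_one_div_add_atTop_nhds_zero_nat.neg.mul_const t)
  simpa using hweight.mul_const (u t)

end CausalVolterra

theorem integral_indicator_Ioi_conv (h u : ℝ → ℂ) (t : ℝ) :
    ∫ s, (Ioi 0).indicator h (t - s) * (Ioi 0).indicator u s
      = (Ioi 0).indicator (fun t => ∫ s in (0 : ℝ)..t, h (t - s) * u s) t := by
  have := congrFun (posConvolution_eq_convolution_indicator u h (mul ℝ ℂ) volume) t
  simpa only [posConvolution, convolution, mul_apply', mul_comm] using this.symm

theorem fourier_exp_mul_indicator_Ioi (h : ℝ → ℂ) (σ y : ℝ) :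
    𝓕 (fun t : ℝ => (Real.exp (-σ * t) : ℂ) * (Ioi 0).indicator h t) y
      = laplace h (σ + 2 * Real.pi * y * Complex.I) := by
  rw [Real.fourier_real_eq_integral_exp_smul, laplace, ← integral_indicator measurableSet_Ioi]
  congr 1; ext t
  by_cases ht : t ∈ Ioi 0
  · simp only [indicator_of_mem ht, smul_eq_mul, ← mul_assoc, Complex.ofReal_exp,
      ← Complex.exp_add]
    congr 2; push_cast; ring
  · simp [ht]

theorem causalVolterra_indicator {h u f : ℝ → ℂ} (hh : Continuous h)
    (hu : ContinuousOn u (Ici 0)) (hint : IntegrableOn h (Ioi 0))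
    (heq : ∀ t, 0 < t → u t = f t + ∫ s in (0 : ℝ)..t, h (t - s) * u s) :
    CausalVolterra ((Ioi 0).indicator h) ((Ioi 0).indicator u) ((Ioi 0).indicator f) := by
  have hhm : Measurable ((Ioi 0).indicator h) := hh.measurable.indicator measurableSet_Ioi
  have hum : Measurable ((Ioi 0).indicator u) := by
    rw [← piecewise_eq_indicator]
    exact (hu.mono Ioi_subset_Ici_self).measurable_piecewise continuousOn_const measurableSet_Ioi
  have heq' (t : ℝ) : (Ioi 0).indicator u t = (Ioi 0).indicator f t +
      ∫ s, (Ioi 0).indicator h (t - s) * (Ioi 0).indicator u s := by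
    rw [integral_indicator_Ioi_conv]
    by_cases ht : t ∈ Ioi 0
    · simpa only [indicator_of_mem ht] using heq t ht
    · simp [ht]
  refine ⟨hhm, hum, ?_, causal_indicator_Ioi h, causal_indicator_Ioi u, causal_indicator_Ioi f,
    (integrable_indicator_iff measurableSet_Ioi).2 hint, fun T => ?_, heq'⟩
  · have hconv : StronglyMeasurable fun z : ℝ × ℝ =>
        (Ioi 0).indicator h (z.1 - z.2) * (Ioi 0).indicator u z.2 :=
      (by fun_prop : Measurable _).stronglyMeasurable
    have hsub : (Ioi 0).indicator f = fun t => (Ioi 0).indicator u t -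
        ∫ s, (Ioi 0).indicator h (t - s) * (Ioi 0).indicator u s :=
      funext fun t => eq_sub_of_add_eq (heq' t).symm
    rw [hsub]
    exact hum.sub hconv.integral_prod_right'.measurable
  · obtain ⟨B, hB⟩ := (isCompact_Icc (a := (0:ℝ)) (b := T)).exists_bound_of_continuousOn
      (hu.mono Icc_subset_Ici_self)
    refine ⟨|B|, fun t ht => ?_⟩
    by_cases h0 : t ∈ Ioi 0
    · rw [indicator_of_mem h0]
      exact (hB t ⟨le_of_lt h0, ht⟩).trans (le_abs_self B)
    · simp [h0]

theorem volterra_eLpNorm_le {h u f : ℝ → ℂ} (hh : Continuous h) (hu : ContinuousOn u (Ici 0))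
    {κ M : ℝ} (hκ : 0 < κ) (hM : ∀ t, ‖h t‖ ≤ M) (hint : IntegrableOn h (Ioi 0))
    (hmom : IntegrableOn (fun t : ℝ => (t : ℂ) * h t) (Ioi 0))
    (hs : ∀ ω : ℂ, 0 < ω.re → κ ≤ ‖1 - laplace h ω‖)
    (heq : ∀ t, 0 < t → u t = f t + ∫ s in (0 : ℝ)..t, h (t - s) * u s) :
    eLpNorm u 2 (volume.restrict (Ioi 0)) ≤
      ENNReal.ofReal (1 / κ) * eLpNorm f 2 (volume.restrict (Ioi 0)) := by
  have hV := causalVolterra_indicator hh hu hint heq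
  simp only [← eLpNorm_indicator_eq_eLpNorm_restrict (measurableSet_Ioi (a := (0 : ℝ)))]
  by_cases htop : eLpNorm ((Ioi 0).indicator f) 2 volume = ∞
  · rw [htop, ENNReal.mul_top (by simpa using hκ)]; exact le_top
  have hf : MemLp ((Ioi 0).indicator f) 2 :=
    ⟨hV.measurable_source.aestronglyMeasurable, lt_top_iff_ne_top.2 htop⟩
  have hM0 : 0 ≤ M := (norm_nonneg _).trans (hM 0)
  obtain ⟨C, hC⟩ := exists_norm_le_add_mul_exp_of_volterra hu (M := M + 1) (by linarith)
    (fun t => (hM t).trans (by linarith)) ((memLp_indicator_iff_restrict measurableSet_Ioi).1 hf)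
    heq
  refine hV.eLpNorm_le hκ ?_ (fun σ hσ y => ?_) hf (b := M + 1) (C := C) fun t ht => ?_
  · exact ((integrable_indicator_iff measurableSet_Ioi).2 hmom).congr
      (Eventually.of_forall fun t => indicator_mul_right _ (fun t : ℝ => (t : ℂ)) h)
  · rw [fourier_exp_mul_indicator_Ioi]
    exact hs _ (by simpa using hσ)
  · simpa only [indicator_of_mem (mem_Ioi.2 ht)] using hC t ht

end CausalVolterra

section PhaseSpace

open scoped LineDeriv

/-- The position derivative of a Schwartz function on phase space. -/
noncomputable def dX (w : 𝓢(ℝ × ℝ, ℂ)) : 𝓢(ℝ × ℝ, ℂ) := ∂_{((1 : ℝ), (0 : ℝ))} w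

/-- The wavenumber derivative of a Schwartz function on phase space. -/
noncomputable def dK (w : 𝓢(ℝ × ℝ, ℂ)) : 𝓢(ℝ × ℝ, ℂ) := ∂_{((0 : ℝ), (1 : ℝ))} w

/-- The restriction of a Schwartz function on phase space to the line of fixed wavenumber `k`. -/
noncomputable def sliceX (k : ℝ) : 𝓢(ℝ × ℝ, ℂ) →L[ℂ] 𝓢(ℝ, ℂ) :=
  SchwartzMap.compCLMOfAntilipschitz (K := 1) (g := fun x : ℝ => (x, k)) ℂ
    (by
      convert (inl ℝ ℝ ℝ).hasTemperateGrowth.add (.const ((0 : ℝ), k)) using 1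
      ext x <;> simp)
    (AntilipschitzWith.of_le_mul_dist fun x y => by simp [Prod.dist_eq])

/-- The restriction of a Schwartz function on phase space to the line of fixed position `x`. -/
noncomputable def sliceK (x : ℝ) : 𝓢(ℝ × ℝ, ℂ) →L[ℂ] 𝓢(ℝ, ℂ) :=
  SchwartzMap.compCLMOfAntilipschitz (K := 1) (g := fun k : ℝ => (x, k)) ℂ
    (by
      convert (inr ℝ ℝ ℝ).hasTemperateGrowth.add (.const (x, (0 : ℝ))) using 1
      ext k <;> simp)
    (AntilipschitzWith.of_le_mul_dist fun x y => by simp [Prod.dist_eq])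

@[simp] theorem sliceX_apply (k : ℝ) (w : 𝓢(ℝ × ℝ, ℂ)) (x : ℝ) : sliceX k w x = w (x, k) := rfl

theorem hasDerivAt_fst (w : 𝓢(ℝ × ℝ, ℂ)) (x k : ℝ) :
    HasDerivAt (fun y => w (y, k)) (dX w (x, k)) x := by
  rw [dX, SchwartzMap.lineDerivOp_apply_eq_fderiv]
  exact (w.hasFDerivAt (x, k)).comp_hasDerivAt x ((hasDerivAt_id x).prodMk (hasDerivAt_const x k))

theorem hasDerivAt_snd (w : 𝓢(ℝ × ℝ, ℂ)) (x k : ℝ) :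
    HasDerivAt (fun y => w (x, y)) (dK w (x, k)) k := by
  rw [dK, SchwartzMap.lineDerivOp_apply_eq_fderiv]
  exact (w.hasFDerivAt (x, k)).comp_hasDerivAt k ((hasDerivAt_const k x).prodMk (hasDerivAt_id k))

theorem derivCLM_sliceX (k : ℝ) (w : 𝓢(ℝ × ℝ, ℂ)) :
    SchwartzMap.derivCLM ℂ ℂ (sliceX k w) = sliceX k (dX w) :=
  SchwartzMap.ext fun x => (hasDerivAt_fst w x k).deriv

theorem derivCLM_sliceK (x : ℝ) (w : 𝓢(ℝ × ℝ, ℂ)) :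
    SchwartzMap.derivCLM ℂ ℂ (sliceK x w) = sliceK x (dK w) :=
  SchwartzMap.ext fun k => (hasDerivAt_snd w x k).deriv

theorem norm_iterate_dX_le (w : 𝓢(ℝ × ℝ, ℂ)) (n : ℕ) (z : ℝ × ℝ) :
    ‖(dX^[n] w) z‖ ≤ ‖iteratedFDeriv ℝ n w z‖ := by
  have hd : dX = LineDeriv.lineDerivOp ((1 : ℝ), (0 : ℝ)) := rfl
  rw [hd, ← LineDeriv.iteratedLineDerivOp_const_eq_iter_lineDerivOp,
    SchwartzMap.iteratedLineDerivOp_eq_iteratedFDeriv]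
  refine (ContinuousMultilinearMap.le_opNorm _ _).trans ?_
  simp [Prod.norm_def]

theorem pow_mul_norm_iterate_dX_le (w : 𝓢(ℝ × ℝ, ℂ)) (j n : ℕ) (x k : ℝ) :
    |x| ^ j * ‖(dX^[n] w) (x, k)‖ ≤
      (SchwartzMap.seminorm ℂ j n w + SchwartzMap.seminorm ℂ (j + 2) n w) * (1 + k ^ 2)⁻¹ := by
  have hx : |x| ≤ ‖(x, k)‖ := norm_fst_le (x, k)
  have hk : k ^ 2 ≤ ‖(x, k)‖ ^ 2 := by
    rw [← sq_abs]; gcongr; exact norm_snd_le (x, k)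
  rw [← div_eq_mul_inv, le_div_iff₀ (by positivity)]
  calc |x| ^ j * ‖(dX^[n] w) (x, k)‖ * (1 + k ^ 2)
      ≤ ‖(x, k)‖ ^ j * ‖iteratedFDeriv ℝ n w (x, k)‖ * (1 + ‖(x, k)‖ ^ 2) := by
        gcongr
        exact norm_iterate_dX_le w n (x, k)
    _ = ‖(x, k)‖ ^ j * ‖iteratedFDeriv ℝ n w (x, k)‖
        + ‖(x, k)‖ ^ (j + 2) * ‖iteratedFDeriv ℝ n w (x, k)‖ := by ring
    _ ≤ _ := add_le_add (SchwartzMap.le_seminorm ℂ j n w (x, k))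
        (SchwartzMap.le_seminorm ℂ (j + 2) n w (x, k))

theorem hasDerivAt_density (w : 𝓢(ℝ × ℝ, ℂ)) (x : ℝ) :
    HasDerivAt (density w) (density (dX w) x) x :=
  (hasDerivAt_integral_of_dominated_loc_of_deriv_le (s := univ)
    (F := fun y ξ => w (y, ξ)) (F' := fun y ξ => dX w (y, ξ)) univ_mem
    (Eventually.of_forall fun y => (sliceK y w).continuous.aestronglyMeasurable)
    (sliceK x w).integrable (sliceK x (dX w)).continuous.aestronglyMeasurable
    (Eventually.of_forall fun ξ y _ => by simpa using pow_mul_norm_iterate_dX_le w 0 1 y ξ)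
    (integrable_inv_one_add_sq.const_mul _)
    (Eventually.of_forall fun ξ y _ => hasDerivAt_fst w y ξ)).2

theorem iteratedDeriv_density (w : 𝓢(ℝ × ℝ, ℂ)) (n : ℕ) :
    iteratedDeriv n (density w) = density (dX^[n] w) := by
  induction n with
  | zero => simp
  | succ n ih =>
    rw [iteratedDeriv_succ, ih, Function.iterate_succ_apply']
    exact funext fun x => (hasDerivAt_density _ x).deriv

theorem pow_mul_norm_iteratedFDeriv_density_le (w : 𝓢(ℝ × ℝ, ℂ)) (j n : ℕ) (x : ℝ) :
    ‖x‖ ^ j * ‖iteratedFDeriv ℝ n (density w) x‖ ≤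
      Real.pi * (SchwartzMap.seminorm ℂ j n w + SchwartzMap.seminorm ℂ (j + 2) n w) := by
  rw [norm_iteratedFDeriv_eq_norm_iteratedDeriv, iteratedDeriv_density]
  calc ‖x‖ ^ j * ‖density (dX^[n] w) x‖
      = ‖∫ ξ : ℝ, ((‖x‖ ^ j : ℝ) : ℂ) * (dX^[n] w) (x, ξ)‖ := by
        rw [integral_const_mul, norm_mul, Complex.norm_of_nonneg (by positivity), density]
    _ ≤ ∫ ξ : ℝ, (SchwartzMap.seminorm ℂ j n w + SchwartzMap.seminorm ℂ (j + 2) n w) *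
          (1 + ξ ^ 2)⁻¹ := by
        refine norm_integral_le_of_norm_le (integrable_inv_one_add_sq.const_mul _)
          (Eventually.of_forall fun ξ => ?_)
        rw [norm_mul, Complex.norm_of_nonneg (by positivity)]
        exact pow_mul_norm_iterate_dX_le w j n x ξ
    _ = _ := by rw [integral_const_mul, integral_univ_inv_one_add_sq, mul_comm]

/-- The position density as a continuous linear map between Schwartz spaces. -/
noncomputable def densityCLM : 𝓢(ℝ × ℝ, ℂ) →L[ℂ] 𝓢(ℝ, ℂ) :=
  SchwartzMap.mkCLM (σ := RingHom.id ℂ) (fun w => density w)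
    (fun f g x => integral_add (sliceK x f).integrable (sliceK x g).integrable)
    (fun a _ _ => integral_const_mul a _)
    (fun f => contDiff_of_differentiable_iteratedDeriv fun n _ => by
      rw [iteratedDeriv_density]
      exact fun x => (hasDerivAt_density _ x).differentiableAt)
    (fun n => by
      have hle {m} (hm : m ∈ ({n, (n.1 + 2, n.2)} : Finset (ℕ × ℕ))) (w : 𝓢(ℝ × ℝ, ℂ)) :
          SchwartzMap.seminorm ℂ m.1 m.2 w ≤ (({n, (n.1 + 2, n.2)} : Finset (ℕ × ℕ)).sup
            (schwartzSeminormFamily ℂ (ℝ × ℝ) ℂ)) w :=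
        Seminorm.le_def.1 (Finset.le_sup (f := schwartzSeminormFamily ℂ (ℝ × ℝ) ℂ) hm) w
      refine ⟨{n, (n.1 + 2, n.2)}, Real.pi * 2, by positivity, fun w x => ?_⟩
      refine (pow_mul_norm_iteratedFDeriv_density_le w n.1 n.2 x).trans ?_
      rw [mul_assoc, two_mul]
      gcongr
      · exact hle (by simp) w
      · exact hle (m := (n.1 + 2, n.2)) (by simp) w)

@[simp] theorem coe_densityCLM (w : 𝓢(ℝ × ℝ, ℂ)) : ⇑(densityCLM w) = density w := rfl

end PhaseSpace

section Interaction

theorem integrable_cexp_mul {α : Type*} [MeasurableSpace α] {μ : Measure α} {φ f : α → ℂ}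
    (hφ : Measurable φ) (hre : ∀ x, (φ x).re = 0) (hf : Integrable f μ) :
    Integrable (fun x => Complex.exp (φ x) * f x) μ :=
  hf.mono (hφ.cexp.aestronglyMeasurable.mul hf.aestronglyMeasurable)
    (Eventually.of_forall fun x => by simp [Complex.norm_exp, hre])

theorem fourier_eq_integral (f : ℝ → ℂ) (X : ℝ) :
    𝓕 f X = ∫ x : ℝ, Complex.exp (-2 * Real.pi * Complex.I * X * x) * f x := by
  rw [Real.fourier_real_eq_integral_exp_smul]
  congr 1; ext x
  rw [smul_eq_mul]; congr 2; push_cast; ring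

theorem fourierInv_eq_integral (f : ℝ → ℂ) (x : ℝ) :
    𝓕⁻ f x = ∫ X : ℝ, Complex.exp (2 * Real.pi * Complex.I * X * x) * f X := by
  rw [Real.fourierInv_eq_fourier_neg, fourier_eq_integral]
  congr 1; ext y; congr 2; push_cast; ring

theorem integral_exp_mul_comp_affine (n : ℝ → ℂ) (x l : ℝ) {ε : ℝ} (hε : ε ≠ 0) :
    ∫ y : ℝ, Complex.exp (-2 * Real.pi * Complex.I * l * y) * n (x + ε * y)
      = |ε⁻¹| • (Complex.exp (2 * Real.pi * Complex.I * (l / ε : ℝ) * x) * 𝓕 n (l / ε)) := by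
  set g : ℝ → ℂ := fun s => Complex.exp (2 * Real.pi * Complex.I * (l / ε : ℝ) * x) *
    (Complex.exp (-2 * Real.pi * Complex.I * (l / ε : ℝ) * s) * n s) with hg
  have hε' : (ε : ℂ) ≠ 0 := by exact_mod_cast hε
  rw [fourier_eq_integral, ← integral_const_mul, ← integral_add_left_eq_self g x,
    ← Measure.integral_comp_mul_left (fun y => g (x + y)) ε]
  congr 1; ext y
  simp only [hg]
  rw [← mul_assoc, ← Complex.exp_add]
  congr 2
  push_cast
  field_simp
  ring

theorem integral_exp_mul_sub_half (n : 𝓢(ℝ, ℂ)) (x l : ℝ) :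
    ∫ y : ℝ, Complex.exp (-2 * Real.pi * Complex.I * l * y) * (n (x + y / 2) - n (x - y / 2))
      = 2 * (Complex.exp (2 * Real.pi * Complex.I * (2 * l : ℝ) * x) * 𝓕 (n : ℝ → ℂ) (2 * l))
        - 2 * (Complex.exp (2 * Real.pi * Complex.I * (-2 * l : ℝ) * x) *
          𝓕 (n : ℝ → ℂ) (-2 * l)) := by
  have hint (ε : ℝ) (hε : ε ≠ 0) : Integrable fun y : ℝ =>
      Complex.exp (-2 * Real.pi * Complex.I * l * y) * n (x + ε * y) :=
    integrable_cexp_mul (by fun_prop) (by simp)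
      (((n.integrable (μ := volume)).comp_add_left x).comp_mul_left' hε)
  have hplus (y : ℝ) : x + y / 2 = x + 2⁻¹ * y := by ring
  have hminus (y : ℝ) : x - y / 2 = x + (-2)⁻¹ * y := by ring
  have hl : l / 2⁻¹ = 2 * l := by ring
  have hl' : l / (-2)⁻¹ = -2 * l := by ring
  simp only [hplus, hminus, mul_sub]
  rw [integral_sub (hint _ (by norm_num)) (hint _ (by norm_num)),
    integral_exp_mul_comp_affine _ _ _ (by norm_num),
    integral_exp_mul_comp_affine _ _ _ (by norm_num), hl, hl']
  simp

/-- The difference `P(k - X/2) - P(k + X/2)`, which replaces the wavenumber derivative of the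
background spectrum. -/
noncomputable def gap (P : ℝ → ℝ) (k X : ℝ) : ℂ := ((P (k - X / 2) - P (k + X / 2) : ℝ) : ℂ)

theorem gap_hasTemperateGrowth (P : 𝓢(ℝ, ℝ)) (k : ℝ) :
    Function.HasTemperateGrowth (gap P k) := by
  have hP := P.hasTemperateGrowth
  have hminus : Function.HasTemperateGrowth fun X : ℝ => k - X / 2 := by
    simp only [div_eq_mul_inv]; fun_prop
  have hplus : Function.HasTemperateGrowth fun X : ℝ => k + X / 2 := by
    simp only [div_eq_mul_inv]; fun_prop
  exact Complex.ofRealCLM.hasTemperateGrowth.comp ((hP.comp hminus).sub (hP.comp hplus))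

theorem integrable_mul_schwartz_comp {g : ℝ → ℂ} (hg : Integrable g) (P : 𝓢(ℝ, ℝ)) {φ : ℝ → ℝ}
    (hφ : Continuous φ) : Integrable fun X => g X * P (φ X) := by
  have hP := P.continuous
  exact hg.mul_bdd (c := SchwartzMap.seminorm ℝ 0 0 P)
    (by fun_prop : Continuous fun X => (P (φ X) : ℂ)).aestronglyMeasurable
    (Eventually.of_forall fun X => by
      simpa using SchwartzMap.norm_le_seminorm ℝ P (φ X))

theorem interaction_eq_fourierInv (P : 𝓢(ℝ, ℝ)) (n : 𝓢(ℝ, ℂ)) (x k : ℝ) :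
    interaction P n x k = (𝓕⁻ (SchwartzMap.smulLeftCLM ℂ (gap P k) (𝓕 n)) : 𝓢(ℝ, ℂ)) x := by
  set g : ℝ → ℂ := fun X =>
    Complex.exp (2 * Real.pi * Complex.I * X * x) * 𝓕 (n : ℝ → ℂ) X with hg
  have hgint : Integrable g := integrable_cexp_mul (by fun_prop) (by simp) (𝓕 n).integrable
  set F : ℝ → ℂ := fun X => g X * P (k - X / 2) with hF
  set G : ℝ → ℂ := fun X => g X * P (k + X / 2) with hG
  have hFint : Integrable F := integrable_mul_schwartz_comp hgint P (by fun_prop)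
  have hGint : Integrable G := integrable_mul_schwartz_comp hgint P (by fun_prop)
  calc interaction P n x k = ∫ l : ℝ, (2 * F (2 * l) - 2 * G (-2 * l)) := by
        rw [interaction]
        congr 1; ext l
        rw [integral_exp_mul_sub_half]
        simp only [hF, hG, hg]
        ring_nf
    _ = ∫ X, F X - G X := by
        rw [integral_sub ((hFint.comp_mul_left' two_ne_zero).const_mul 2)
          ((hGint.comp_mul_left' (by norm_num)).const_mul 2), integral_const_mul,
          integral_const_mul, Measure.integral_comp_mul_left, Measure.integral_comp_mul_left,
          integral_sub hFint hGint]
        simp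
    _ = _ := by
        rw [SchwartzMap.fourierInv_coe, fourierInv_eq_integral]
        congr 1; ext X
        simp only [hF, hG, hg, SchwartzMap.smulLeftCLM_apply_apply (gap_hasTemperateGrowth P k),
          SchwartzMap.fourier_coe, gap, smul_eq_mul]
        push_cast; ring

end Interaction

section TimeContinuity

theorem volume_prod_restrict (S : Set ℝ) :
    (volume : Measure ℝ).prod ((volume : Measure ℝ).restrict S)
      = (volume : Measure (ℝ × ℝ)).restrict (univ ×ˢ S) := by
  rw [Measure.volume_eq_prod, ← Measure.prod_restrict, Measure.restrict_univ]

theorem continuousOn_schwartz_uncurry {E : Type*} [NormedAddCommGroup E] [NormedSpace ℝ E]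
    {G : ℝ → 𝓢(E, ℂ)} {S : Set ℝ} (hG : ContinuousOn G S) :
    ContinuousOn (fun z : E × ℝ => G z.2 z.1) (univ ×ˢ S) := by
  have hbdd : ContinuousOn
      (fun t => SchwartzMap.toBoundedContinuousFunctionCLM ℂ E ℂ (G t)) S :=
    (ContinuousLinearMap.continuous _).comp_continuousOn hG
  have hpair : ContinuousOn (fun z : E × ℝ =>
      (SchwartzMap.toBoundedContinuousFunctionCLM ℂ E ℂ (G z.2), z.1)) (univ ×ˢ S) :=
    (hbdd.comp continuousOn_snd fun z hz => hz.2).prodMk continuousOn_fst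
  exact continuous_eval.comp_continuousOn hpair

theorem continuousOn_schwartz_apply {E : Type*} [NormedAddCommGroup E] [NormedSpace ℝ E]
    {G : ℝ → 𝓢(E, ℂ)} {S : Set ℝ} (hG : ContinuousOn G S) (x : E) :
    ContinuousOn (fun t => G t x) S :=
  (continuousOn_schwartz_uncurry hG).comp (f := fun t : ℝ => (x, t)) (by fun_prop)
    fun t ht => ⟨trivial, ht⟩

theorem aestronglyMeasurable_schwartz_uncurry {G : ℝ → 𝓢(ℝ, ℂ)} {S : Set ℝ}
    (hG : ContinuousOn G S) (hS : MeasurableSet S) :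
    AEStronglyMeasurable (fun z : ℝ × ℝ => G z.2 z.1)
      ((volume : Measure ℝ).prod ((volume : Measure ℝ).restrict S)) := by
  rw [volume_prod_restrict]
  exact (continuousOn_schwartz_uncurry hG).aestronglyMeasurable (MeasurableSet.univ.prod hS)

theorem exists_norm_le_mul_inv_one_add_sq {G : ℝ → 𝓢(ℝ, ℂ)} {K : Set ℝ} (hK : IsCompact K)
    (hG : ContinuousOn G K) : ∃ C, ∀ t ∈ K, ∀ x, ‖G t x‖ ≤ C * (1 + x ^ 2)⁻¹ := by
  have hc (j : ℕ) : Continuous fun f : 𝓢(ℝ, ℂ) => SchwartzMap.seminorm ℂ j 0 f :=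
    (schwartz_withSeminorms ℂ ℝ ℂ).continuous_seminorm (j, 0)
  obtain ⟨C, hC⟩ := hK.exists_bound_of_continuousOn (((hc 0).add (hc 2)).comp_continuousOn hG)
  refine ⟨C, fun t ht x => ?_⟩
  have hsum := (le_abs_self _).trans (hC t ht)
  have h0 := SchwartzMap.norm_pow_mul_le_seminorm ℂ (G t) 0 x
  have h2 := SchwartzMap.norm_pow_mul_le_seminorm ℂ (G t) 2 x
  simp only [Function.comp, Pi.add_apply] at hsum
  simp only [Real.norm_eq_abs, pow_zero, one_mul, sq_abs] at h0 h2
  rw [← div_eq_mul_inv, le_div_iff₀ (by positivity)]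
  linarith

theorem integrable_schwartz_uncurry {G : ℝ → 𝓢(ℝ, ℂ)} {a b : ℝ} (hG : ContinuousOn G (Icc a b)) :
    Integrable (fun z : ℝ × ℝ => G z.2 z.1)
      ((volume : Measure ℝ).prod ((volume : Measure ℝ).restrict (Ioc a b))) := by
  obtain ⟨C, hC⟩ := exists_norm_le_mul_inv_one_add_sq isCompact_Icc hG
  have hbound : Integrable (fun z : ℝ × ℝ => (C * (1 + z.1 ^ 2)⁻¹) * (1 : ℝ))
      ((volume : Measure ℝ).prod ((volume : Measure ℝ).restrict (Ioc a b))) :=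
    (integrable_inv_one_add_sq.const_mul C).mul_prod (integrable_const 1)
  refine hbound.mono'
    (aestronglyMeasurable_schwartz_uncurry (hG.mono Ioc_subset_Icc_self) measurableSet_Ioc) ?_
  rw [volume_prod_restrict]
  filter_upwards [ae_restrict_mem (MeasurableSet.univ.prod measurableSet_Ioc)] with z hz
  rw [mul_one]
  exact hC z.2 (Ioc_subset_Icc_self hz.2) z.1

theorem fourier_eq_add_integral {v G : ℝ → 𝓢(ℝ, ℂ)} (hv : ContinuousOn v (Ici 0))
    (hG : ContinuousOn G (Ici 0))
    (hd : ∀ t, 0 < t → ∀ x, HasDerivAt (fun τ => v τ x) (G t x) t) (X : ℝ) {t : ℝ} (ht : 0 ≤ t) :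
    𝓕 (v t) X = 𝓕 (v 0) X + ∫ s in (0 : ℝ)..t, 𝓕 (G s) X := by
  have hIcc : Icc 0 t ⊆ Ici (0 : ℝ) := Icc_subset_Ici_self
  have hftc (x : ℝ) : v t x - v 0 x = ∫ s in (0 : ℝ)..t, G s x :=
    (intervalIntegral.integral_eq_sub_of_hasDerivAt_of_le ht
      ((continuousOn_schwartz_apply hv x).mono hIcc) (fun s hs => hd s hs.1 x)
      (((continuousOn_schwartz_apply hG x).mono hIcc).intervalIntegrable_of_Icc ht)).symm
  have hprod : Integrable (fun z : ℝ × ℝ => Complex.exp (-2 * Real.pi * Complex.I * X * z.1) *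
      G z.2 z.1) (volume.prod (volume.restrict (Ioc 0 t))) :=
    integrable_cexp_mul (by fun_prop) (by simp) (integrable_schwartz_uncurry (hG.mono hIcc))
  have hslice (f : 𝓢(ℝ, ℂ)) : Integrable fun x : ℝ =>
      Complex.exp (-2 * Real.pi * Complex.I * X * x) * f x :=
    integrable_cexp_mul (by fun_prop) (by simp) f.integrable
  rw [← sub_eq_iff_eq_add']
  simp only [SchwartzMap.fourier_coe, fourier_eq_integral]
  rw [← integral_sub (hslice _) (hslice _), intervalIntegral.integral_of_le ht,
    ← integral_integral_swap hprod]
  congr 1; ext x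
  rw [← mul_sub, hftc, integral_const_mul, intervalIntegral.integral_of_le ht]

theorem fourier_derivCLM_apply (f : 𝓢(ℝ, ℂ)) (X : ℝ) :
    𝓕 (SchwartzMap.derivCLM ℂ ℂ f) X = 2 * Real.pi * Complex.I * X * 𝓕 f X :=
  congrFun (Real.fourier_deriv (f := f) f.integrable f.differentiable
    (SchwartzMap.derivCLM ℂ ℂ f).integrable) X

end TimeContinuity

section Duhamel

theorem hasDerivAt_of_eq_add_integral {y g : ℝ → ℂ} (hg : ContinuousOn g (Ici 0))
    (h : ∀ t, 0 ≤ t → y t = y 0 + ∫ s in (0 : ℝ)..t, g s) {t : ℝ} (ht : 0 < t) :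
    HasDerivAt y (g t) t := by
  have hnhds : Ici (0 : ℝ) ∈ 𝓝 t := Ici_mem_nhds ht
  have hint : HasDerivAt (fun r => ∫ τ in (0 : ℝ)..r, g τ) (g t) t :=
    intervalIntegral.integral_hasDerivAt_right
      ((hg.mono Icc_subset_Ici_self).intervalIntegrable_of_Icc ht.le)
      ((hg.stronglyMeasurableAtFilter_nhdsWithin measurableSet_Ici t).filter_mono
        (by rw [nhdsWithin_eq_nhds.2 hnhds])) (hg.continuousAt hnhds)
  refine (hint.const_add (y 0)).congr_of_eventuallyEq ?_
  filter_upwards [hnhds] with r hr using h r hr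

theorem eq_exp_mul_add_integral {y g : ℝ → ℂ} {θ : ℂ} (hy : ContinuousOn y (Ici 0))
    (hg : ContinuousOn g (Ici 0))
    (h : ∀ t, 0 ≤ t → y t = y 0 + ∫ s in (0 : ℝ)..t, (-θ * y s + g s)) {t : ℝ} (ht : 0 ≤ t) :
    y t = Complex.exp (-θ * t) * y 0 +
      ∫ s in (0 : ℝ)..t, Complex.exp (-θ * (t - s : ℝ)) * g s := by
  have hIcc : Icc 0 t ⊆ Ici (0 : ℝ) := Icc_subset_Ici_self
  have hdy (s : ℝ) (hs : s ∈ Ioo 0 t) : HasDerivAt y (-θ * y s + g s) s :=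
    hasDerivAt_of_eq_add_integral ((continuousOn_const.mul hy).add hg) h hs.1
  have hdE (s : ℝ) : HasDerivAt (fun s : ℝ => Complex.exp (-θ * (t - s : ℝ)))
      (Complex.exp (-θ * (t - s : ℝ)) * θ) s := by
    simpa using (((hasDerivAt_id s).const_sub t).ofReal_comp.const_mul (-θ)).cexp
  have hE : Continuous fun s : ℝ => Complex.exp (-θ * (t - s : ℝ)) := by fun_prop
  rw [intervalIntegral.integral_eq_sub_of_hasDerivAt_of_le ht
    (f := fun s => Complex.exp (-θ * (t - s : ℝ)) * y s)
    (f' := fun s => Complex.exp (-θ * (t - s : ℝ)) * g s)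
    (hE.continuousOn.mul (hy.mono hIcc))
    (fun s hs => ((hdE s).mul (hdy s hs)).congr_deriv (by ring))
    ((hE.continuousOn.mul (hg.mono hIcc)).intervalIntegrable_of_Icc ht)]
  simp

variable {p q : ℝ} {P : 𝓢(ℝ, ℝ)} {w₀ : 𝓢(ℝ × ℝ, ℂ)} {w : ℝ → 𝓢(ℝ × ℝ, ℂ)}

/-- The right-hand side of the linearised Alber equation, solved for the time derivative, on the
line of fixed wavenumber `k`. -/
noncomputable def sliceGenerator (p q : ℝ) (P : 𝓢(ℝ, ℝ)) (k : ℝ) :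
    𝓢(ℝ × ℝ, ℂ) →L[ℂ] 𝓢(ℝ, ℂ) :=
  (-(2 * Real.pi * p * k : ℂ)) • (SchwartzMap.derivCLM ℂ ℂ ∘L sliceX k) +
    (q * Complex.I : ℂ) • (FourierTransform.fourierInvCLM ℂ 𝓢(ℝ, ℂ) ∘L
      SchwartzMap.smulLeftCLM ℂ (gap P k) ∘L FourierTransform.fourierCLM ℂ 𝓢(ℝ, ℂ) ∘L densityCLM)

theorem sliceGenerator_apply (k : ℝ) (v : 𝓢(ℝ × ℝ, ℂ)) :
    sliceGenerator p q P k v =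
      (-(2 * Real.pi * p * k : ℂ)) • SchwartzMap.derivCLM ℂ ℂ (sliceX k v) +
      (q * Complex.I : ℂ) • 𝓕⁻ (SchwartzMap.smulLeftCLM ℂ (gap P k) (𝓕 (densityCLM v))) := rfl

theorem fourier_sliceGenerator_apply (k : ℝ) (v : 𝓢(ℝ × ℝ, ℂ)) (X : ℝ) :
    𝓕 (sliceGenerator p q P k v) X =
      -(2 * Real.pi * Complex.I * (2 * Real.pi * p * X) * k) * 𝓕 (sliceX k v) X +
      q * Complex.I * gap P k X * 𝓕 (densityCLM v) X := by
  simp only [sliceGenerator_apply, FourierTransform.fourier_add, FourierTransform.fourier_smul,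
    FourierTransform.fourier_fourierInv_eq, add_apply, smul_apply, smul_eq_mul,
    fourier_derivCLM_apply, SchwartzMap.smulLeftCLM_apply_apply (gap_hasTemperateGrowth P k)]
  ring

theorem IsSolution.hasDerivAt_sliceX (hw : IsSolution p q P w₀ w) (k : ℝ) {t : ℝ} (ht : 0 < t)
    (x : ℝ) : HasDerivAt (fun τ => sliceX k (w τ) x) (sliceGenerator p q P k (w t) x) t := by
  obtain ⟨hdiff, hder⟩ := hw.equation t ht x k
  rw [← coe_densityCLM, interaction_eq_fourierInv] at hder
  refine hdiff.hasDerivAt.congr_deriv ?_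
  have hx : SchwartzMap.derivCLM ℂ ℂ (sliceX k (w t)) x = deriv (fun y => w t (y, k)) x := rfl
  rw [sliceGenerator_apply, add_apply, smul_apply, smul_apply, hx, smul_eq_mul, smul_eq_mul]
  linear_combination hder

theorem IsSolution.continuousOn_fourier_density (hw : IsSolution p q P w₀ w) :
    ContinuousOn (fun t => 𝓕 (densityCLM (w t))) (Ici 0) :=
  (FourierTransform.fourierCLM ℂ 𝓢(ℝ, ℂ) ∘L densityCLM).continuous.comp_continuousOn
    hw.continuousOn

theorem IsSolution.fourier_sliceX_eq (hw : IsSolution p q P w₀ w) (k X : ℝ) {t : ℝ}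
    (ht : 0 ≤ t) :
    𝓕 (sliceX k (w t)) X =
      Complex.exp (-2 * Real.pi * Complex.I * (2 * Real.pi * p * X * t : ℝ) * k) *
        𝓕 (sliceX k w₀) X + ∫ s in (0 : ℝ)..t,
      Complex.exp (-2 * Real.pi * Complex.I * (2 * Real.pi * p * X * (t - s) : ℝ) * k) *
        (q * Complex.I * gap P k X * 𝓕 (densityCLM (w s)) X) := by
  set θ : ℂ := 2 * Real.pi * Complex.I * (2 * Real.pi * p * X) * k with hθ
  have hphase (τ : ℝ) :
      -2 * Real.pi * Complex.I * (2 * Real.pi * p * X * τ : ℝ) * k = -θ * τ := by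
    rw [hθ]; push_cast; ring
  have hslice : ContinuousOn (fun t => sliceX k (w t)) (Ici 0) :=
    (sliceX k).continuous.comp_continuousOn hw.continuousOn
  simp only [hphase]
  rw [← hw.initial]
  refine eq_exp_mul_add_integral (y := fun t => 𝓕 (sliceX k (w t)) X)
    (g := fun s => q * Complex.I * gap P k X * 𝓕 (densityCLM (w s)) X)
    (continuousOn_schwartz_apply
      ((FourierTransform.fourierCLM ℂ 𝓢(ℝ, ℂ)).continuous.comp_continuousOn hslice) X)
    (continuousOn_const.mul (continuousOn_schwartz_apply hw.continuousOn_fourier_density X))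
    (fun t ht => ?_) ht
  simp only [hθ, ← fourier_sliceGenerator_apply]
  exact fourier_eq_add_integral hslice
    ((sliceGenerator p q P k).continuous.comp_continuousOn hw.continuousOn)
    (fun t ht x => hw.hasDerivAt_sliceX k ht x) X ht

end Duhamel

section Volterra

theorem integrable_exp_mul_prod (w : 𝓢(ℝ × ℝ, ℂ)) (X η : ℝ) :
    Integrable (fun z : ℝ × ℝ => Complex.exp (-2 * Real.pi * Complex.I * η * z.2) *
      (Complex.exp (-2 * Real.pi * Complex.I * X * z.1) * w z))
      ((volume : Measure ℝ).prod volume) :=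
  integrable_cexp_mul (by fun_prop) (by simp)
    (integrable_cexp_mul (by fun_prop) (by simp) (w.integrable (μ := volume)))

/-- The Fourier transform on phase space, as an iterated integral: `X` is dual to `x` and `η` is
dual to `k`. -/
noncomputable def fourier₂ (w : 𝓢(ℝ × ℝ, ℂ)) (X η : ℝ) : ℂ :=
  ∫ k : ℝ, Complex.exp (-2 * Real.pi * Complex.I * η * k) * 𝓕 (sliceX k w) X

theorem fourier_sliceX_apply (w : 𝓢(ℝ × ℝ, ℂ)) (k X : ℝ) :
    𝓕 (sliceX k w) X = ∫ x : ℝ, Complex.exp (-2 * Real.pi * Complex.I * X * x) * w (x, k) :=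
  fourier_eq_integral _ X

theorem fourier_sliceK_apply (w : 𝓢(ℝ × ℝ, ℂ)) (x η : ℝ) :
    𝓕 (sliceK x w) η = ∫ k : ℝ, Complex.exp (-2 * Real.pi * Complex.I * η * k) * w (x, k) :=
  fourier_eq_integral _ η

theorem integrable_exp_mul_fourier_sliceX (w : 𝓢(ℝ × ℝ, ℂ)) (X η : ℝ) :
    Integrable fun k : ℝ => Complex.exp (-2 * Real.pi * Complex.I * η * k) *
      𝓕 (sliceX k w) X := by
  simpa only [integral_const_mul, ← fourier_sliceX_apply] using
    (integrable_exp_mul_prod w X η).integral_prod_right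

theorem fourier₂_eq_integral_prod (w : 𝓢(ℝ × ℝ, ℂ)) (X η : ℝ) :
    fourier₂ w X η = ∫ z : ℝ × ℝ, Complex.exp (-2 * Real.pi * Complex.I * η * z.2) *
      (Complex.exp (-2 * Real.pi * Complex.I * X * z.1) * w z) := by
  rw [Measure.volume_eq_prod, integral_prod_symm _ (integrable_exp_mul_prod w X η)]
  simp only [fourier₂, fourier_sliceX_apply, integral_const_mul]

theorem fourier₂_eq_integral_fourier_sliceK (w : 𝓢(ℝ × ℝ, ℂ)) (X η : ℝ) :
    fourier₂ w X η = ∫ x : ℝ, Complex.exp (-2 * Real.pi * Complex.I * X * x) *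
      𝓕 (sliceK x w) η := by
  rw [fourier₂_eq_integral_prod, Measure.volume_eq_prod,
    integral_prod _ (integrable_exp_mul_prod w X η)]
  simp only [fourier_sliceK_apply, ← integral_const_mul, mul_left_comm]

theorem fourier_density_eq (w : 𝓢(ℝ × ℝ, ℂ)) (X : ℝ) :
    𝓕 (densityCLM w) X = fourier₂ w X 0 := by
  rw [fourier₂_eq_integral_fourier_sliceK, SchwartzMap.fourier_coe, fourier_eq_integral]
  simp [fourier_sliceK_apply, density]

theorem integrable_gap (P : 𝓢(ℝ, ℝ)) (X : ℝ) : Integrable fun k : ℝ => gap P k X :=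
  ((P.integrable.comp_sub_right (X / 2)).sub (P.integrable.comp_add_right (X / 2))).ofReal

theorem continuous_gap (P : 𝓢(ℝ, ℝ)) : Continuous fun z : ℝ × ℝ => gap P z.1 z.2 := by
  have hP := P.continuous
  unfold gap
  fun_prop

theorem integral_exp_mul_gap (P : 𝓢(ℝ, ℝ)) (X η : ℝ) :
    ∫ k : ℝ, Complex.exp (-2 * Real.pi * Complex.I * η * k) * gap P k X
      = -2 * Complex.I * Real.sin (Real.pi * X * η) * 𝓕 (fun k : ℝ => (P k : ℂ)) η := by
  have hshift (a : ℝ) : ∫ k : ℝ, Complex.exp (-2 * Real.pi * Complex.I * η * k) * P (k + a)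
      = Complex.exp (2 * Real.pi * Complex.I * η * a) * 𝓕 (fun k : ℝ => (P k : ℂ)) η := by
    simpa [add_comm] using
      integral_exp_mul_comp_affine (fun k : ℝ => (P k : ℂ)) a η one_ne_zero
  have hP : Integrable fun k : ℝ => (P k : ℂ) := P.integrable.ofReal
  have hint (a : ℝ) : Integrable fun k : ℝ =>
      Complex.exp (-2 * Real.pi * Complex.I * η * k) * P (k + a) :=
    integrable_cexp_mul (by fun_prop) (by simp) (hP.comp_add_right a)
  have hgap (k : ℝ) : gap P k X = P (k + -X / 2) - P (k + X / 2) := by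
    rw [gap, show k + -X / 2 = k - X / 2 by ring]; push_cast; rfl
  simp only [hgap, mul_sub]
  rw [integral_sub (hint _) (hint _), hshift, hshift, Complex.ofReal_sin, Complex.sin]
  push_cast
  ring_nf
  simp only [Complex.I_sq]
  ring

theorem kernelH_neg_eq (p q : ℝ) (P : 𝓢(ℝ, ℝ)) (X τ : ℝ) :
    kernelH p q P (-X) τ = q * Complex.I * ∫ k : ℝ,
      Complex.exp (-2 * Real.pi * Complex.I * (2 * Real.pi * p * X * τ : ℝ) * k) * gap P k X := by
  rw [integral_exp_mul_gap, kernelH, Real.fourierInv_eq_fourier_neg]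
  ring_nf
  simp only [Complex.I_sq]
  ring

variable {p q : ℝ} {P : 𝓢(ℝ, ℝ)} {w₀ : 𝓢(ℝ × ℝ, ℂ)} {w : ℝ → 𝓢(ℝ × ℝ, ℂ)}

theorem IsSolution.integrable_exp_mul_gap_mul (hw : IsSolution p q P w₀ w) (X t : ℝ) :
    Integrable (fun z : ℝ × ℝ =>
      Complex.exp (-2 * Real.pi * Complex.I * (2 * Real.pi * p * X * (t - z.2) : ℝ) * z.1) *
        (q * Complex.I * gap P z.1 X * 𝓕 (densityCLM (w z.2)) X))
      (volume.prod (volume.restrict (Ioc 0 t))) := by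
  have hn : IntegrableOn (fun s => 𝓕 (densityCLM (w s)) X) (Ioc 0 t) :=
    (((continuousOn_schwartz_apply hw.continuousOn_fourier_density X).mono
      Icc_subset_Ici_self).integrableOn_Icc).mono_set Ioc_subset_Icc_self
  exact integrable_cexp_mul (by fun_prop) (by simp)
    (((integrable_gap P X).const_mul (q * Complex.I)).mul_prod hn)

theorem IsSolution.volterra (hw : IsSolution p q P w₀ w) (X : ℝ) {t : ℝ} (ht : 0 ≤ t) :
    𝓕 (densityCLM (w t)) X = fourier₂ w₀ X (2 * Real.pi * p * X * t) +
      ∫ s in (0 : ℝ)..t, kernelH p q P (-X) (t - s) * 𝓕 (densityCLM (w s)) X := by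
  have hprod := hw.integrable_exp_mul_gap_mul X t
  simp only [intervalIntegral.integral_of_le ht]
  calc 𝓕 (densityCLM (w t)) X = ∫ k : ℝ, 𝓕 (sliceX k (w t)) X := by
        rw [fourier_density_eq, fourier₂]; simp
    _ = fourier₂ w₀ X (2 * Real.pi * p * X * t) + ∫ k : ℝ, ∫ s in Ioc (0 : ℝ) t,
          Complex.exp (-2 * Real.pi * Complex.I * (2 * Real.pi * p * X * (t - s) : ℝ) * k) *
            (q * Complex.I * gap P k X * 𝓕 (densityCLM (w s)) X) := by
        simp only [hw.fourier_sliceX_eq _ X ht, intervalIntegral.integral_of_le ht]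
        exact integral_add (integrable_exp_mul_fourier_sliceX w₀ X _) hprod.integral_prod_left
    _ = _ := by
        rw [integral_integral_swap hprod]
        congr 2; ext s
        rw [kernelH_neg_eq, ← integral_const_mul, ← integral_mul_const]
        congr 1; ext k
        ring

end Volterra

section PhaseSpaceFourier

theorem fourier₂_dX (w : 𝓢(ℝ × ℝ, ℂ)) (X η : ℝ) :
    fourier₂ (dX w) X η = 2 * Real.pi * Complex.I * X * fourier₂ w X η := by
  simp only [fourier₂, ← derivCLM_sliceX, fourier_derivCLM_apply, mul_left_comm (Complex.exp _),
    integral_const_mul]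

theorem fourier₂_dK (w : 𝓢(ℝ × ℝ, ℂ)) (X η : ℝ) :
    fourier₂ (dK w) X η = 2 * Real.pi * Complex.I * η * fourier₂ w X η := by
  simp only [fourier₂_eq_integral_fourier_sliceK, ← derivCLM_sliceK, fourier_derivCLM_apply,
    mul_left_comm (Complex.exp _), integral_const_mul]

theorem norm_fourier₂_iterate (w : 𝓢(ℝ × ℝ, ℂ)) (c d : ℕ) (X η : ℝ) :
    ‖fourier₂ (dX^[c] (dK^[d] w)) X η‖ =
      (2 * Real.pi * |X|) ^ c * ((2 * Real.pi * |η|) ^ d * ‖fourier₂ w X η‖) := by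
  have hX (v : 𝓢(ℝ × ℝ, ℂ)) : ‖fourier₂ (dX v) X η‖ = 2 * Real.pi * |X| * ‖fourier₂ v X η‖ := by
    simp [fourier₂_dX, abs_of_pos Real.pi_pos]
  have hη (v : 𝓢(ℝ × ℝ, ℂ)) : ‖fourier₂ (dK v) X η‖ = 2 * Real.pi * |η| * ‖fourier₂ v X η‖ := by
    simp [fourier₂_dK, abs_of_pos Real.pi_pos]
  induction c with
  | zero =>
    induction d with
    | zero => simp
    | succ d ih => simp_all only [Function.iterate_succ_apply', Function.iterate_zero, id_eq]; ring
  | succ c ih => rw [Function.iterate_succ_apply', hX, ih]; ring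

theorem norm_exp_mul_exp_mul (a b x y : ℝ) (c : ℂ) :
    ‖Complex.exp (-2 * Real.pi * Complex.I * a * x) *
      (Complex.exp (-2 * Real.pi * Complex.I * b * y) * c)‖ = ‖c‖ := by
  simp [Complex.norm_exp]

theorem norm_fourier₂_le {w : 𝓢(ℝ × ℝ, ℂ)} {B : ℝ}
    (hB : ∀ x k : ℝ, (1 + x ^ 2) * (1 + k ^ 2) * ‖w (x, k)‖ ≤ B) (X η : ℝ) :
    ‖fourier₂ w X η‖ ≤ Real.pi ^ 2 * B := by
  have hint : Integrable (fun z : ℝ × ℝ => B * ((1 + z.1 ^ 2)⁻¹ * (1 + z.2 ^ 2)⁻¹)) :=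
    (integrable_inv_one_add_sq.mul_prod integrable_inv_one_add_sq).const_mul B
  rw [fourier₂_eq_integral_prod]
  refine (norm_integral_le_of_norm_le hint (.of_forall fun z => ?_)).trans_eq ?_
  · rw [norm_exp_mul_exp_mul, ← mul_inv, ← div_eq_mul_inv, le_div_iff₀ (by positivity), mul_comm]
    exact hB z.1 z.2
  · rw [integral_const_mul, Measure.volume_eq_prod,
      integral_prod_mul (fun x : ℝ => (1 + x ^ 2)⁻¹) (fun k : ℝ => (1 + k ^ 2)⁻¹)]
    simp only [integral_univ_inv_one_add_sq]
    ring

theorem pow_mul_norm_fourier₂_le {w : 𝓢(ℝ × ℝ, ℂ)} {A : ℝ} {c d : ℕ}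
    (hA : ∀ a b : ℕ, a ≤ 2 → b ≤ 2 → ∀ x k : ℝ,
      |x| ^ a * |k| ^ b * ‖(dX^[c] (dK^[d] w)) (x, k)‖ ≤ A) (X η : ℝ) :
    |X| ^ c * (|η| ^ d * ‖fourier₂ w X η‖) ≤ Real.pi ^ 2 * (4 * A) := by
  have hpi (y : ℝ) : |y| ≤ 2 * Real.pi * |y| :=
    le_mul_of_one_le_left (abs_nonneg y) (by linarith [Real.pi_gt_three])
  calc |X| ^ c * (|η| ^ d * ‖fourier₂ w X η‖)
      ≤ (2 * Real.pi * |X|) ^ c * ((2 * Real.pi * |η|) ^ d * ‖fourier₂ w X η‖) := by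
        gcongr <;> exact hpi _
    _ = ‖fourier₂ (dX^[c] (dK^[d] w)) X η‖ := (norm_fourier₂_iterate w c d X η).symm
    _ ≤ Real.pi ^ 2 * (4 * A) := by
        refine norm_fourier₂_le (fun x k => ?_) X η
        have h00 := hA 0 0 (by norm_num) (by norm_num) x k
        have h02 := hA 0 2 (by norm_num) le_rfl x k
        have h20 := hA 2 0 le_rfl (by norm_num) x k
        have h22 := hA 2 2 le_rfl le_rfl x k
        simp only [pow_zero, one_mul, mul_one, sq_abs] at h00 h02 h20 h22
        linarith

theorem norm_fourier₂_le_inv_one_add_sq {w : 𝓢(ℝ × ℝ, ℂ)} {A : ℝ}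
    (hA : ∀ a b c d : ℕ, a ≤ 2 → b ≤ 2 → c ≤ 2 → d ≤ 2 → ∀ x k : ℝ,
      |x| ^ a * |k| ^ b * ‖(dX^[c] (dK^[d] w)) (x, k)‖ ≤ A) (X η : ℝ) :
    ‖fourier₂ w X η‖ ≤ 16 * Real.pi ^ 2 * A * ((1 + X ^ 2)⁻¹ * (1 + η ^ 2)⁻¹) := by
  have hF (c d : ℕ) (hc : c ≤ 2) (hd : d ≤ 2) :=
    pow_mul_norm_fourier₂_le (fun a b ha hb => hA a b c d ha hb hc hd) X η
  have h00 := hF 0 0 (by norm_num) (by norm_num)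
  have h02 := hF 0 2 (by norm_num) le_rfl
  have h20 := hF 2 0 le_rfl (by norm_num)
  have h22 := hF 2 2 le_rfl le_rfl
  simp only [pow_zero, one_mul, sq_abs] at h00 h02 h20 h22
  rw [← mul_inv, ← div_eq_mul_inv, le_div_iff₀ (by positivity)]
  linarith

theorem iteratedDeriv_snd (w : 𝓢(ℝ × ℝ, ℂ)) (d : ℕ) (x : ℝ) :
    iteratedDeriv d (fun k => w (x, k)) = fun k => (dK^[d] w) (x, k) := by
  induction d with
  | zero => simp
  | succ d ih =>
    rw [iteratedDeriv_succ, ih, Function.iterate_succ_apply']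
    ext k
    exact (hasDerivAt_snd _ x k).deriv

theorem iteratedDeriv_fst (w : 𝓢(ℝ × ℝ, ℂ)) (c : ℕ) (k : ℝ) :
    iteratedDeriv c (fun x => w (x, k)) = fun x => (dX^[c] w) (x, k) := by
  induction c with
  | zero => simp
  | succ c ih =>
    rw [iteratedDeriv_succ, ih, Function.iterate_succ_apply']
    ext x
    exact (hasDerivAt_fst _ x k).deriv

theorem sigmaNorm_eq (s : ℕ) (p : ℝ≥0∞) (w : 𝓢(ℝ × ℝ, ℂ)) :
    sigmaNorm s p w = ∑ a ∈ Finset.range (s + 1), ∑ b ∈ Finset.range (s + 1),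
      ∑ c ∈ Finset.range (s + 1), ∑ d ∈ Finset.range (s + 1), if a + b + c + d ≤ s then
        eLpNorm (fun z => (z.1 : ℂ) ^ a * (z.2 : ℂ) ^ b * (dX^[c] (dK^[d] w)) z) p volume
      else 0 := by
  simp only [sigmaNorm, iteratedDeriv_snd, iteratedDeriv_fst]

theorem enorm_le_eLpNorm_top {E F : Type*} [TopologicalSpace E] [MeasurableSpace E]
    {μ : Measure E} [μ.IsOpenPosMeasure] [NormedAddCommGroup F] {f : E → F} (hf : Continuous f)
    (z : E) : ‖f z‖ₑ ≤ eLpNorm f ∞ μ := by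
  have hae : ∀ᵐ z ∂μ, ‖f z‖ₑ ≤ eLpNorm f ∞ μ := by
    rw [eLpNorm_exponent_top]
    exact ae_le_eLpNormEssSup
  have hclosed : IsClosed {z | ‖f z‖ₑ ≤ eLpNorm f ∞ μ} := isClosed_le hf.enorm continuous_const
  exact hclosed.closure_subset ((Measure.dense_of_ae hae).closure_eq ▸ mem_univ z)

theorem ofReal_weighted_deriv_le_sigmaNorm (w : 𝓢(ℝ × ℝ, ℂ)) {s a b c d : ℕ}
    (h : a + b + c + d ≤ s) (x k : ℝ) :
    ENNReal.ofReal (|x| ^ a * |k| ^ b * ‖(dX^[c] (dK^[d] w)) (x, k)‖) ≤ sigmaNorm s ∞ w := by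
  have hcont : Continuous fun z : ℝ × ℝ =>
      (z.1 : ℂ) ^ a * (z.2 : ℂ) ^ b * (dX^[c] (dK^[d] w)) z := by
    have := (dX^[c] (dK^[d] w)).continuous
    fun_prop
  have hmem {n : ℕ} (hn : n ≤ s) : n ∈ Finset.range (s + 1) := Finset.mem_range_succ_iff.2 hn
  calc ENNReal.ofReal (|x| ^ a * |k| ^ b * ‖(dX^[c] (dK^[d] w)) (x, k)‖)
      = ‖(x : ℂ) ^ a * (k : ℂ) ^ b * (dX^[c] (dK^[d] w)) (x, k)‖ₑ := by
        rw [← ofReal_norm]; simp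
    _ ≤ eLpNorm (fun z : ℝ × ℝ => (z.1 : ℂ) ^ a * (z.2 : ℂ) ^ b * (dX^[c] (dK^[d] w)) z) ∞
          volume := enorm_le_eLpNorm_top hcont (x, k)
    _ ≤ sigmaNorm s ∞ w := by
        rw [sigmaNorm_eq]
        refine le_trans ?_ (Finset.single_le_sum (fun _ _ => zero_le) (hmem (n := a) (by omega)))
        refine le_trans ?_ (Finset.single_le_sum (fun _ _ => zero_le) (hmem (n := b) (by omega)))
        refine le_trans ?_ (Finset.single_le_sum (fun _ _ => zero_le) (hmem (n := c) (by omega)))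
        refine le_trans ?_ (Finset.single_le_sum (fun _ _ => zero_le) (hmem (n := d) (by omega)))
        rw [if_pos h]

theorem sigmaNorm_top_ne_top (s : ℕ) (w : 𝓢(ℝ × ℝ, ℂ)) : sigmaNorm s ∞ w ≠ ∞ := by
  rw [sigmaNorm_eq]
  refine ENNReal.sum_ne_top.2 fun a _ => ENNReal.sum_ne_top.2 fun b _ =>
    ENNReal.sum_ne_top.2 fun c _ => ENNReal.sum_ne_top.2 fun d _ => ?_
  split_ifs
  · set g := dX^[c] (dK^[d] w)
    have hg := g.continuous
    refine (memLp_top_of_bound (C := SchwartzMap.seminorm ℂ (a + b) 0 g)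
      (Continuous.aestronglyMeasurable (by fun_prop)) (.of_forall fun z => ?_)).2.ne
    refine le_trans ?_ (SchwartzMap.norm_pow_mul_le_seminorm ℂ g (a + b) z)
    rw [norm_mul, norm_mul, norm_pow, norm_pow, Complex.norm_real, Complex.norm_real, pow_add]
    gcongr
    · exact norm_fst_le z
    · exact norm_snd_le z
  · exact ENNReal.zero_ne_top

theorem norm_fourier₂_le_sigmaNorm (w : 𝓢(ℝ × ℝ, ℂ)) (X η : ℝ) :
    ‖fourier₂ w X η‖ ≤ 16 * Real.pi ^ 2 * (sigmaNorm 8 ∞ w).toReal *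
      ((1 + X ^ 2)⁻¹ * (1 + η ^ 2)⁻¹) :=
  norm_fourier₂_le_inv_one_add_sq (fun _ _ _ _ ha hb hc hd x k =>
    (ENNReal.ofReal_le_iff_le_toReal (sigmaNorm_top_ne_top 8 w)).1
      (ofReal_weighted_deriv_le_sigmaNorm w (by omega) x k)) X η

theorem exists_norm_fourier₂_le (w : 𝓢(ℝ × ℝ, ℂ)) :
    ∃ A : ℝ, 0 ≤ A ∧ ∀ X η : ℝ, ‖fourier₂ w X η‖ ≤ A * ((1 + X ^ 2)⁻¹ * (1 + η ^ 2)⁻¹) :=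
  ⟨16 * Real.pi ^ 2 * (sigmaNorm 8 ∞ w).toReal, by positivity, norm_fourier₂_le_sigmaNorm w⟩

theorem continuous_fourier₂ (w : 𝓢(ℝ × ℝ, ℂ)) :
    Continuous fun z : ℝ × ℝ => fourier₂ w z.1 z.2 := by
  have hw := w.continuous
  simp only [fourier₂_eq_integral_prod]
  refine continuous_of_dominated (bound := fun y => ‖w y‖)
    (fun z => Continuous.aestronglyMeasurable (by fun_prop)) (fun z => .of_forall fun y => ?_)
    (w.integrable (μ := volume)).norm (.of_forall fun y => by fun_prop)
  exact (norm_exp_mul_exp_mul ..).le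

theorem fourier₂_add (v w : 𝓢(ℝ × ℝ, ℂ)) (X η : ℝ) :
    fourier₂ (v + w) X η = fourier₂ v X η + fourier₂ w X η := by
  simp only [fourier₂_eq_integral_prod, Measure.volume_eq_prod]
  rw [← integral_add (integrable_exp_mul_prod v X η) (integrable_exp_mul_prod w X η)]
  simp only [add_apply, mul_add]

theorem fourier₂_smul (c : ℂ) (w : 𝓢(ℝ × ℝ, ℂ)) (X η : ℝ) :
    fourier₂ (c • w) X η = c * fourier₂ w X η := by
  simp only [fourier₂_eq_integral_prod, ← integral_const_mul, smul_apply, smul_eq_mul,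
    mul_left_comm c]

end PhaseSpaceFourier

section Kernel

/-- The inverse Fourier transform `P̌` of the spectrum, as a Schwartz function. -/
noncomputable def specInv (P : 𝓢(ℝ, ℝ)) : 𝓢(ℝ, ℂ) :=
  𝓕⁻ (SchwartzMap.postcompCLM (𝕜 := ℝ) Complex.ofRealCLM P)

theorem kernelH_eq (p q : ℝ) (P : 𝓢(ℝ, ℝ)) (X t : ℝ) :
    kernelH p q P X t = 2 * q * Real.sin (2 * Real.pi ^ 2 * p * X ^ 2 * t) *
      specInv P (2 * Real.pi * p * X * t) := by
  rw [kernelH, specInv, SchwartzMap.fourierInv_coe]; rfl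

theorem continuous_kernelH (p q : ℝ) (P : 𝓢(ℝ, ℝ)) :
    Continuous fun z : ℝ × ℝ => kernelH p q P z.1 z.2 := by
  simp only [kernelH_eq]
  have := (specInv P).continuous
  fun_prop

theorem norm_kernelH_eq (p q : ℝ) (P : 𝓢(ℝ, ℝ)) (X t : ℝ) :
    ‖kernelH p q P X t‖ = 2 * |q| * |Real.sin (2 * Real.pi ^ 2 * p * X ^ 2 * t)| *
      ‖specInv P (2 * Real.pi * p * X * t)‖ := by
  rw [kernelH_eq, norm_mul, norm_mul, norm_mul, Complex.norm_real, Complex.norm_real,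
    Complex.norm_ofNat, Real.norm_eq_abs, Real.norm_eq_abs]

theorem norm_kernelH_le (p q : ℝ) (P : 𝓢(ℝ, ℝ)) (X t : ℝ) :
    ‖kernelH p q P X t‖ ≤ 2 * |q| * ‖specInv P (2 * Real.pi * p * X * t)‖ := by
  rw [norm_kernelH_eq]
  exact mul_le_mul_of_nonneg_right
    (mul_le_of_le_one_right (by positivity) (Real.abs_sin_le_one _)) (norm_nonneg _)

theorem exists_norm_kernelH_le (p q : ℝ) (P : 𝓢(ℝ, ℝ)) :
    ∃ M : ℝ, 0 < M ∧ ∀ X t, ‖kernelH p q P X t‖ ≤ M := by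
  refine ⟨2 * |q| * SchwartzMap.seminorm ℂ 0 0 (specInv P) + 1, by positivity, fun X t => ?_⟩
  calc ‖kernelH p q P X t‖ ≤ 2 * |q| * ‖specInv P (2 * Real.pi * p * X * t)‖ :=
        norm_kernelH_le p q P X t
    _ ≤ 2 * |q| * SchwartzMap.seminorm ℂ 0 0 (specInv P) := by
        gcongr
        exact SchwartzMap.norm_le_seminorm ℂ (specInv P) _
    _ ≤ _ := (lt_add_one _).le

theorem continuous_kernelH_right (p q : ℝ) (P : 𝓢(ℝ, ℝ)) (X : ℝ) :
    Continuous (kernelH p q P X) :=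
  (continuous_kernelH p q P).comp (f := fun t : ℝ => (X, t)) (by fun_prop)

variable {p X : ℝ}

theorem integrable_kernelH (hp : p ≠ 0) (q : ℝ) (P : 𝓢(ℝ, ℝ)) (hX : X ≠ 0) :
    Integrable (kernelH p q P X) := by
  have hc : 2 * Real.pi * p * X ≠ 0 := by simp [hp, hX, Real.pi_ne_zero]
  exact ((((specInv P).integrable (μ := volume)).comp_mul_left' hc).norm.const_mul
    (2 * |q|)).mono' (continuous_kernelH_right p q P X).aestronglyMeasurable
    (.of_forall (norm_kernelH_le p q P X))

/-- The bound `|sin y| ≤ |y|` gains the factor `X² |t|`, which after rescaling time by `X` makes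
the first moment of the kernel of order `1 / |X|`. -/
theorem norm_mul_kernelH_le (hp : p ≠ 0) (q : ℝ) (P : 𝓢(ℝ, ℝ)) (X t : ℝ) :
    ‖(t : ℂ) * kernelH p q P X t‖ ≤ |q| / |p| *
      (‖2 * Real.pi * p * X * t‖ ^ 2 * ‖specInv P (2 * Real.pi * p * X * t)‖) := by
  have := abs_pos.2 hp
  rw [norm_mul, norm_kernelH_eq, Complex.norm_real, Real.norm_eq_abs, Real.norm_eq_abs]
  calc |t| * (2 * |q| * |Real.sin (2 * Real.pi ^ 2 * p * X ^ 2 * t)| *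
        ‖specInv P (2 * Real.pi * p * X * t)‖)
      ≤ |t| * (2 * |q| * |2 * Real.pi ^ 2 * p * X ^ 2 * t| *
        ‖specInv P (2 * Real.pi * p * X * t)‖) := by
        gcongr |t| * (2 * |q| * ?_ * _)
        exact Real.abs_sin_le_abs
    _ = _ := by
        simp only [abs_mul, abs_pow, abs_two, abs_of_pos Real.pi_pos]
        field_simp

theorem integrable_mul_kernelH (hp : p ≠ 0) (q : ℝ) (P : 𝓢(ℝ, ℝ)) (hX : X ≠ 0) :
    Integrable fun t : ℝ => (t : ℂ) * kernelH p q P X t := by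
  have hc : 2 * Real.pi * p * X ≠ 0 := by simp [hp, hX, Real.pi_ne_zero]
  exact ((((specInv P).integrable_pow_mul volume 2).comp_mul_left' hc).const_mul _).mono'
    (Complex.continuous_ofReal.mul (continuous_kernelH_right p q P X)).aestronglyMeasurable
    (.of_forall (norm_mul_kernelH_le hp q P X))

theorem exists_integral_norm_mul_kernelH_le (hp : p ≠ 0) (q : ℝ) (P : 𝓢(ℝ, ℝ)) :
    ∃ C : ℝ, 0 ≤ C ∧ ∀ X, X ≠ 0 → ∫ t : ℝ, ‖(t : ℂ) * kernelH p q P X t‖ ≤ C / |X| := by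
  refine ⟨|q| / |p| * (|2 * Real.pi * p|⁻¹ * ∫ y : ℝ, ‖y‖ ^ 2 * ‖specInv P y‖), by positivity,
    fun X hX => ?_⟩
  have hc : 2 * Real.pi * p * X ≠ 0 := by simp [hp, hX, Real.pi_ne_zero]
  have hint := ((specInv P).integrable_pow_mul volume 2).comp_mul_left' hc
  calc ∫ t : ℝ, ‖(t : ℂ) * kernelH p q P X t‖
      ≤ ∫ t : ℝ, |q| / |p| *
        (‖2 * Real.pi * p * X * t‖ ^ 2 * ‖specInv P (2 * Real.pi * p * X * t)‖) :=
        integral_mono (integrable_mul_kernelH hp q P hX).norm (hint.const_mul _)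
          (norm_mul_kernelH_le hp q P X)
    _ = _ := by
        rw [integral_const_mul, Measure.integral_comp_mul_left
          (fun y => ‖y‖ ^ 2 * ‖specInv P y‖), smul_eq_mul, abs_inv, abs_mul _ X]
        field_simp

end Kernel

section DensityGradient

/-- Lebesgue measure on `ℝ × (0, ∞)`: position or frequency first, positive time second. -/
noncomputable abbrev spaceTime : Measure (ℝ × ℝ) := volume.prod (volume.restrict (Ioi 0))

theorem lintegral_sq_deriv_eq (n : 𝓢(ℝ, ℂ)) :
    ∫⁻ x : ℝ, ‖deriv n x‖ₑ ^ 2 =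
      ∫⁻ X : ℝ, ENNReal.ofReal ((2 * Real.pi * |X|) ^ 2) * ‖𝓕 n X‖ₑ ^ 2 := by
  have hnorm (X : ℝ) : ENNReal.ofReal ((2 * Real.pi * |X|) ^ 2) * ‖𝓕 n X‖ₑ ^ 2 =
      ‖𝓕 (SchwartzMap.derivCLM ℂ ℂ n) X‖ₑ ^ 2 := by
    have hfactor : ‖2 * Real.pi * Complex.I * X‖ = 2 * Real.pi * |X| := by
      simp [abs_of_pos Real.pi_pos]
    rw [fourier_derivCLM_apply, enorm_mul, mul_pow ‖_‖ₑ, ← ofReal_norm (_ * (X : ℂ)), hfactor,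
      ENNReal.ofReal_pow (by positivity)]
  have hplancherel := eLpNorm_fourier_two (SchwartzMap.derivCLM ℂ ℂ n).integrable
    ((SchwartzMap.derivCLM ℂ ℂ n).memLp 2)
  simp only [hnorm]
  rw [← eLpNorm_two_sq, ← eLpNorm_two_sq]
  exact congrArg (· ^ 2) hplancherel.symm

theorem lintegral_sq_deriv_spaceTime {n : ℝ → 𝓢(ℝ, ℂ)} (hn : ContinuousOn n (Ioi 0)) :
    ∫⁻ z, ‖deriv (n z.2) z.1‖ₑ ^ 2 ∂spaceTime =
      ∫⁻ X : ℝ, ENNReal.ofReal ((2 * Real.pi * |X|) ^ 2) *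
        ∫⁻ t in Ioi (0 : ℝ), ‖𝓕 (n t) X‖ₑ ^ 2 := by
  have hderiv : AEStronglyMeasurable (fun z : ℝ × ℝ => deriv (n z.2) z.1) spaceTime :=
    aestronglyMeasurable_schwartz_uncurry (G := fun t => SchwartzMap.derivCLM ℂ ℂ (n t))
      ((SchwartzMap.derivCLM ℂ ℂ).continuous.comp_continuousOn hn) measurableSet_Ioi
  have hfourier : AEStronglyMeasurable (fun z : ℝ × ℝ => 𝓕 (n z.2) z.1) spaceTime :=
    aestronglyMeasurable_schwartz_uncurry (G := fun t => 𝓕 (n t))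
      ((FourierTransform.fourierCLM ℂ 𝓢(ℝ, ℂ)).continuous.comp_continuousOn hn) measurableSet_Ioi
  have hweighted : AEMeasurable (fun z : ℝ × ℝ =>
      ENNReal.ofReal ((2 * Real.pi * |z.1|) ^ 2) * ‖𝓕 (n z.2) z.1‖ₑ ^ 2) spaceTime :=
    (Measurable.aemeasurable (by fun_prop)).mul (hfourier.enorm.pow_const 2)
  calc ∫⁻ z, ‖deriv (n z.2) z.1‖ₑ ^ 2 ∂spaceTime
      = ∫⁻ t in Ioi (0 : ℝ), ∫⁻ x : ℝ, ‖deriv (n t) x‖ₑ ^ 2 :=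
        lintegral_prod_symm _ (hderiv.enorm.pow_const 2)
    _ = ∫⁻ t in Ioi (0 : ℝ), ∫⁻ X : ℝ,
          ENNReal.ofReal ((2 * Real.pi * |X|) ^ 2) * ‖𝓕 (n t) X‖ₑ ^ 2 := by
        simp only [lintegral_sq_deriv_eq]
    _ = ∫⁻ X : ℝ, ∫⁻ t in Ioi (0 : ℝ),
          ENNReal.ofReal ((2 * Real.pi * |X|) ^ 2) * ‖𝓕 (n t) X‖ₑ ^ 2 :=
        (lintegral_lintegral_swap hweighted).symm
    _ = _ := by simp only [lintegral_const_mul' _ _ ENNReal.ofReal_ne_top]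

variable {p q κ : ℝ} {P : 𝓢(ℝ, ℝ)}

theorem StableWith.eLpNorm_le (hs : StableWith p q P κ) (hp : p ≠ 0) {X : ℝ} (hX : X ≠ 0)
    {u f : ℝ → ℂ} (hu : ContinuousOn u (Ici 0))
    (heq : ∀ t, 0 < t → u t = f t + ∫ s in (0 : ℝ)..t, kernelH p q P (-X) (t - s) * u s) :
    eLpNorm u 2 (volume.restrict (Ioi 0)) ≤
      ENNReal.ofReal (1 / κ) * eLpNorm f 2 (volume.restrict (Ioi 0)) := by
  obtain ⟨M, -, hM⟩ := exists_norm_kernelH_le p q P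
  exact volterra_eLpNorm_le (continuous_kernelH_right p q P (-X)) hu hs.1 (hM (-X))
    (integrable_kernelH hp q P (neg_ne_zero.2 hX)).integrableOn
    (integrable_mul_kernelH hp q P (neg_ne_zero.2 hX)).integrableOn (hs.2 (-X)) heq

theorem integrable_inv_one_add_mul_sq {c : ℝ} (hc : c ≠ 0) :
    Integrable fun t : ℝ => (1 + (c * t) ^ 2)⁻¹ :=
  integrable_inv_one_add_sq.comp_mul_left' hc

theorem integral_inv_one_add_mul_sq (c : ℝ) :
    ∫ t : ℝ, (1 + (c * t) ^ 2)⁻¹ = Real.pi / |c| := by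
  rw [Measure.integral_comp_mul_left (fun y : ℝ => (1 + y ^ 2)⁻¹) c,
    integral_univ_inv_one_add_sq, smul_eq_mul, abs_inv]
  ring

theorem setLIntegral_sq_le_of_sq_norm_le {f : ℝ → ℂ} {c B : ℝ} (hc : c ≠ 0) (hB : 0 ≤ B)
    (hf : ∀ t, ‖f t‖ ^ 2 ≤ B * (1 + (c * t) ^ 2)⁻¹) (S : Set ℝ) :
    ∫⁻ t in S, ‖f t‖ₑ ^ 2 ≤ ENNReal.ofReal (B * (Real.pi / |c|)) := by
  calc ∫⁻ t in S, ‖f t‖ₑ ^ 2 ≤ ∫⁻ t, ‖f t‖ₑ ^ 2 := setLIntegral_le_lintegral _ _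
    _ ≤ ∫⁻ t, ENNReal.ofReal (B * (1 + (c * t) ^ 2)⁻¹) := by
        refine lintegral_mono fun t => ?_
        rw [← ofReal_norm, ← ENNReal.ofReal_pow (norm_nonneg _)]
        exact ENNReal.ofReal_le_ofReal (hf t)
    _ = ENNReal.ofReal (B * (Real.pi / |c|)) := by
        rw [← ofReal_integral_eq_lintegral_ofReal ((integrable_inv_one_add_mul_sq hc).const_mul _)
          (.of_forall fun t => by positivity), integral_const_mul, integral_inv_one_add_mul_sq]

variable {w₀ : 𝓢(ℝ × ℝ, ℂ)} {w : ℝ → 𝓢(ℝ × ℝ, ℂ)} {A : ℝ}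

theorem lintegral_sq_fourier₂_le (hp : p ≠ 0)
    (hA : ∀ X η : ℝ, ‖fourier₂ w₀ X η‖ ≤ A * ((1 + X ^ 2)⁻¹ * (1 + η ^ 2)⁻¹)) {X : ℝ}
    (hX : X ≠ 0) :
    ∫⁻ t in Ioi (0 : ℝ), ‖fourier₂ w₀ X (2 * Real.pi * p * X * t)‖ₑ ^ 2
      ≤ ENNReal.ofReal ((A * (1 + X ^ 2)⁻¹) ^ 2 / (2 * |p| * |X|)) := by
  have := abs_pos.2 hp
  have := abs_pos.2 hX
  have hc : 2 * Real.pi * p * X ≠ 0 := by simp [hp, hX, Real.pi_ne_zero]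
  have hbound (t : ℝ) : ‖fourier₂ w₀ X (2 * Real.pi * p * X * t)‖ ^ 2 ≤
      (A * (1 + X ^ 2)⁻¹) ^ 2 * (1 + (2 * Real.pi * p * X * t) ^ 2)⁻¹ := by
    set η := 2 * Real.pi * p * X * t
    have hle : (1 + η ^ 2)⁻¹ ≤ 1 := inv_le_one_of_one_le₀ (by linarith [sq_nonneg η])
    calc ‖fourier₂ w₀ X η‖ ^ 2 ≤ (A * ((1 + X ^ 2)⁻¹ * (1 + η ^ 2)⁻¹)) ^ 2 := by
          gcongr; exact hA X η
      _ = (A * (1 + X ^ 2)⁻¹) ^ 2 * (1 + η ^ 2)⁻¹ * (1 + η ^ 2)⁻¹ := by ring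
      _ ≤ _ := mul_le_of_le_one_right (by positivity) hle
  refine (setLIntegral_sq_le_of_sq_norm_le hc (by positivity) hbound _).trans_eq ?_
  simp only [abs_mul, abs_two, abs_of_pos Real.pi_pos]
  congr 1
  field_simp

theorem IsSolution.lintegral_sq_fourier_density_le (hw : IsSolution p q P w₀ w) (hp : p ≠ 0)
    (hs : StableWith p q P κ)
    (hA : ∀ X η : ℝ, ‖fourier₂ w₀ X η‖ ≤ A * ((1 + X ^ 2)⁻¹ * (1 + η ^ 2)⁻¹)) {X : ℝ}
    (hX : X ≠ 0) :
    ∫⁻ t in Ioi (0 : ℝ), ‖𝓕 (densityCLM (w t)) X‖ₑ ^ 2 ≤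
      ENNReal.ofReal ((1 / κ) ^ 2 * ((A * (1 + X ^ 2)⁻¹) ^ 2 / (2 * |p| * |X|))) := by
  have hκ := hs.1
  have hL2 := hs.eLpNorm_le hp hX
    (continuousOn_schwartz_apply hw.continuousOn_fourier_density X)
    (f := fun t => fourier₂ w₀ X (2 * Real.pi * p * X * t)) (fun t ht => hw.volterra X ht.le)
  have hsq := pow_le_pow_left' hL2 2
  rw [mul_pow, eLpNorm_two_sq, eLpNorm_two_sq, ← ENNReal.ofReal_pow (by positivity)] at hsq
  rw [ENNReal.ofReal_mul (by positivity)]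
  exact hsq.trans (by gcongr; exact lintegral_sq_fourier₂_le hp hA hX)

theorem IsSolution.lintegral_sq_deriv_density_le (hw : IsSolution p q P w₀ w) (hp : p ≠ 0)
    (hs : StableWith p q P κ)
    (hA : ∀ X η : ℝ, ‖fourier₂ w₀ X η‖ ≤ A * ((1 + X ^ 2)⁻¹ * (1 + η ^ 2)⁻¹)) :
    ∫⁻ z, ‖deriv (density (w z.2)) z.1‖ₑ ^ 2 ∂spaceTime
      ≤ ENNReal.ofReal ((A / κ) ^ 2 * (2 * Real.pi ^ 3 / |p|)) := by
  have hκ := hs.1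
  have := abs_pos.2 hp
  have hn : ContinuousOn (fun t => densityCLM (w t)) (Ioi 0) :=
    densityCLM.continuous.comp_continuousOn (hw.continuousOn.mono Ioi_subset_Ici_self)
  calc ∫⁻ z, ‖deriv (density (w z.2)) z.1‖ₑ ^ 2 ∂spaceTime
      = ∫⁻ X : ℝ, ENNReal.ofReal ((2 * Real.pi * |X|) ^ 2) *
          ∫⁻ t in Ioi (0 : ℝ), ‖𝓕 (densityCLM (w t)) X‖ₑ ^ 2 := by
        simpa only [coe_densityCLM] using lintegral_sq_deriv_spaceTime hn
    _ ≤ ∫⁻ X : ℝ, ENNReal.ofReal ((A / κ) ^ 2 * (2 * Real.pi ^ 2 / |p|) * (1 + X ^ 2)⁻¹) := by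
        refine lintegral_mono_ae ((Measure.ae_ne volume (0 : ℝ)).mono fun X hX => ?_)
        have hX' : 0 < |X| := abs_pos.2 hX
        have hle : |X| * (1 + X ^ 2)⁻¹ ≤ 1 := by
          rw [← div_eq_mul_inv, div_le_one (by positivity), ← sq_abs]
          nlinarith [sq_nonneg (|X| - 1)]
        refine (mul_le_mul_right (hw.lintegral_sq_fourier_density_le hp hs hA hX) _).trans ?_
        rw [← ENNReal.ofReal_mul (by positivity)]
        refine ENNReal.ofReal_le_ofReal ?_
        calc (2 * Real.pi * |X|) ^ 2 *
              ((1 / κ) ^ 2 * ((A * (1 + X ^ 2)⁻¹) ^ 2 / (2 * |p| * |X|)))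
            = (A / κ) ^ 2 * (2 * Real.pi ^ 2 / |p|) * (1 + X ^ 2)⁻¹ * (|X| * (1 + X ^ 2)⁻¹) := by
              field_simp
          _ ≤ _ := mul_le_of_le_one_right (by positivity) hle
    _ = _ := by
        rw [← ofReal_integral_eq_lintegral_ofReal (integrable_inv_one_add_sq.const_mul _)
          (.of_forall fun X => by positivity), integral_const_mul, integral_univ_inv_one_add_sq]
        congr 1; ring

theorem IsSolution.eLpNorm_deriv_density_le (hw : IsSolution p q P w₀ w) (hp : p ≠ 0)
    (hs : StableWith p q P κ) :
    eLpNorm (fun z : ℝ × ℝ => deriv (density (w z.2)) z.1) 2 spaceTime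
      ≤ ENNReal.ofReal (16 * Real.pi ^ 2 * √(2 * Real.pi ^ 3 / |p|) / κ) * sigmaNorm 8 ∞ w₀ := by
  have hκ := hs.1
  have hsqrt : √(2 * Real.pi ^ 3 / |p|) ^ 2 = 2 * Real.pi ^ 3 / |p| :=
    Real.sq_sqrt (by positivity)
  rw [← ENNReal.pow_le_pow_left_iff (n := 2) two_ne_zero, eLpNorm_two_sq]
  refine (hw.lintegral_sq_deriv_density_le hp hs (norm_fourier₂_le_sigmaNorm w₀)).trans_eq ?_
  conv_rhs => rw [← ENNReal.ofReal_toReal (sigmaNorm_top_ne_top 8 w₀)]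
  rw [← ENNReal.ofReal_mul (by positivity), ← ENNReal.ofReal_pow (by positivity)]
  congr 1
  linear_combination (-(16 * Real.pi ^ 2 * (sigmaNorm 8 ∞ w₀).toReal / κ) ^ 2) * hsqrt

end DensityGradient

section VolterraResolvent

theorem integral_exp_neg_mul_sub_le {σ : ℝ} (hσ : 0 < σ) (T : ℝ) :
    ∫ s in (0 : ℝ)..T, Real.exp (-σ * (T - s)) ≤ 1 / σ := by
  have hderiv (s : ℝ) : HasDerivAt (fun s => Real.exp (-σ * (T - s)) / σ)
      (Real.exp (-σ * (T - s))) s := by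
    refine (((hasDerivAt_id s).const_sub T).const_mul (-σ)).exp.div_const σ |>.congr_deriv ?_
    simp only [id_eq]
    field_simp
  rw [intervalIntegral.integral_eq_sub_of_hasDerivAt (fun s _ => hderiv s)
    (Continuous.intervalIntegrable (by fun_prop) _ _), sub_self, mul_zero, Real.exp_zero]
  linarith [show 0 ≤ Real.exp (-σ * (T - 0)) / σ by positivity]

variable {Y : Type*} {h : Y → ℝ → ℂ} {M σ : ℝ}

/-- The Volterra integral of `v` with kernel `h y (t - s) e^{-σ (t - s)}`, at `z = (y, t)`. The
exponential weight makes it a contraction for large `σ`; negative times are sent to `0`. -/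
noncomputable def volterraIntegral (h : Y → ℝ → ℂ) (σ : ℝ) (v : Y × ℝ → ℂ) (z : Y × ℝ) : ℂ :=
  ∫ s in (0 : ℝ)..max z.2 0,
    h z.1 (max z.2 0 - s) * (Real.exp (-σ * (max z.2 0 - s)) : ℂ) * v (z.1, s)

theorem norm_volterraIntegral_le (hσ : 0 < σ) {B : ℝ} (hM : ∀ y t, ‖h y t‖ ≤ M)
    {v : Y × ℝ → ℂ} (hv : ∀ z, ‖v z‖ ≤ B) (z : Y × ℝ) :
    ‖volterraIntegral h σ v z‖ ≤ M / σ * B := by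
  have hM₀ : 0 ≤ M := (norm_nonneg _).trans (hM z.1 0)
  have hB : 0 ≤ B := (norm_nonneg _).trans (hv z)
  set T := max z.2 0
  have hbound (s : ℝ) : ‖h z.1 (T - s) * (Real.exp (-σ * (T - s)) : ℂ) * v (z.1, s)‖ ≤
      M * B * Real.exp (-σ * (T - s)) := by
    rw [norm_mul, norm_mul, Complex.norm_real, Real.norm_eq_abs, Real.abs_exp]
    calc _ ≤ M * Real.exp (-σ * (T - s)) * B := by gcongr <;> apply_assumption
      _ = _ := by ring
  calc ‖volterraIntegral h σ v z‖ ≤ ∫ s in (0 : ℝ)..T, M * B * Real.exp (-σ * (T - s)) :=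
        intervalIntegral.norm_integral_le_of_norm_le (le_max_right _ _)
          (.of_forall fun s _ => hbound s) (Continuous.intervalIntegrable (by fun_prop) _ _)
    _ ≤ M * B * (1 / σ) := by
        rw [intervalIntegral.integral_const_mul]
        gcongr
        exact integral_exp_neg_mul_sub_le hσ T
    _ = M / σ * B := by ring

variable [TopologicalSpace Y]

theorem continuous_volterraIntegrand (hc : Continuous (Function.uncurry h)) (σ : ℝ)
    {v : Y × ℝ → ℂ} (hv : Continuous v) :
    Continuous (Function.uncurry fun (z : Y × ℝ) (s : ℝ) =>
      h z.1 (max z.2 0 - s) * (Real.exp (-σ * (max z.2 0 - s)) : ℂ) * v (z.1, s)) := by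
  have hh : Continuous fun y : (Y × ℝ) × ℝ => h y.1.1 (max y.1.2 0 - y.2) :=
    hc.comp (f := fun y : (Y × ℝ) × ℝ => (y.1.1, max y.1.2 0 - y.2)) (by fun_prop)
  exact (hh.mul (by fun_prop)).mul (hv.comp (by fun_prop))

theorem continuous_volterraIntegral (hc : Continuous (Function.uncurry h)) (σ : ℝ)
    {v : Y × ℝ → ℂ} (hv : Continuous v) : Continuous (volterraIntegral h σ v) :=
  intervalIntegral.continuous_parametric_intervalIntegral_of_continuous
    (continuous_volterraIntegrand hc σ hv) (s := fun z : Y × ℝ => max z.2 0) (by fun_prop)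

/-- `volterraIntegral` as a bounded operator on bounded continuous functions. -/
noncomputable def volterraCLM (hc : Continuous (Function.uncurry h)) (hσ : 0 < σ) (hM₀ : 0 ≤ M)
    (hM : ∀ y t, ‖h y t‖ ≤ M) : (Y × ℝ →ᵇ ℂ) →L[ℂ] (Y × ℝ →ᵇ ℂ) :=
  LinearMap.mkContinuous
    { toFun := fun v => .ofNormedAddCommGroup (volterraIntegral h σ v)
        (continuous_volterraIntegral hc σ v.continuous) (M / σ * ‖v‖)
        (norm_volterraIntegral_le hσ hM v.norm_coe_le_norm)
      map_add' := fun v w => by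
        ext z
        have hint (v : Y × ℝ →ᵇ ℂ) := ((continuous_volterraIntegrand hc σ v.continuous).comp
          (Continuous.prodMk_right z)).intervalIntegrable (μ := volume) 0 (max z.2 0)
        simp only [BoundedContinuousFunction.coe_ofNormedAddCommGroup, volterraIntegral,
          BoundedContinuousFunction.coe_add, Pi.add_apply, mul_add]
        exact intervalIntegral.integral_add (hint v) (hint w)
      map_smul' := fun c v => by
        ext z
        simp only [BoundedContinuousFunction.coe_ofNormedAddCommGroup, volterraIntegral,
          BoundedContinuousFunction.coe_smul, smul_eq_mul, RingHom.id_apply, mul_left_comm _ c,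
          intervalIntegral.integral_const_mul] }
    (M / σ) fun v => BoundedContinuousFunction.norm_ofNormedAddCommGroup_le _ (by positivity)
      (norm_volterraIntegral_le hσ hM v.norm_coe_le_norm)

theorem norm_volterraCLM_le (hc : Continuous (Function.uncurry h)) (hσ : 0 < σ) (hM₀ : 0 ≤ M)
    (hM : ∀ y t, ‖h y t‖ ≤ M) : ‖volterraCLM hc hσ hM₀ hM‖ ≤ M / σ :=
  LinearMap.mkContinuous_norm_le _ (by positivity) _

theorem exists_resolvent {𝕜 E : Type*} [NontriviallyNormedField 𝕜] [NormedAddCommGroup E]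
    [NormedSpace 𝕜 E] [CompleteSpace E] {K : E →L[𝕜] E} (hK : ‖K‖ < 1) :
    ∃ R : E →L[𝕜] E, ∀ F, R F = F + K (R F) := by
  refine ⟨↑(Units.oneSub K hK)⁻¹, fun F => sub_eq_iff_eq_add.1 ?_⟩
  exact congrArg (· F) (Units.oneSub K hK).mul_inv

theorem volterra_of_weighted {h v : ℝ → ℂ} {f : ℂ} {σ t : ℝ}
    (hv : v t = (Real.exp (-σ * t) : ℂ) * f +
      ∫ s in (0 : ℝ)..t, h (t - s) * (Real.exp (-σ * (t - s)) : ℂ) * v s) :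
    (Real.exp (σ * t) : ℂ) * v t =
      f + ∫ s in (0 : ℝ)..t, h (t - s) * ((Real.exp (σ * s) : ℂ) * v s) := by
  have hcancel : (Real.exp (σ * t) : ℂ) * Real.exp (-σ * t) = 1 := by
    rw [← Complex.ofReal_mul, ← Real.exp_add]
    simp
  have hsplit (s : ℝ) : (Real.exp (σ * s) : ℂ) = Real.exp (σ * t) * Real.exp (-σ * (t - s)) := by
    rw [← Complex.ofReal_mul, ← Real.exp_add]
    congr 2
    ring
  rw [hv, mul_add, ← mul_assoc, hcancel, one_mul, ← intervalIntegral.integral_const_mul]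
  congr 2 with s
  rw [hsplit s]
  ring

theorem exists_linearMap_volterra (hc : Continuous (Function.uncurry h))
    (hM : ∀ y t, ‖h y t‖ ≤ M) :
    ∃ U : (Y × ℝ →ᵇ ℂ) →ₗ[ℂ] (Y × ℝ → ℂ), (∀ f, Continuous (U f)) ∧
      ∀ f y t, 0 ≤ t → U f (y, t) = f (y, t) + ∫ s in (0 : ℝ)..t, h y (t - s) * U f (y, s) := by
  set σ := |M| + 1
  have hσ : 0 < σ := by positivity
  have hK : ‖volterraCLM hc hσ (abs_nonneg M) fun y t => (hM y t).trans (le_abs_self M)‖ < 1 :=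
    (norm_volterraCLM_le _ _ _ _).trans_lt ((div_lt_one hσ).2 (lt_add_one _))
  obtain ⟨R, hR⟩ := exists_resolvent hK
  let weight : Y × ℝ →ᵇ ℂ := .ofNormedAddCommGroup
    (fun z => (Real.exp (-σ * max z.2 0) : ℂ)) (by fun_prop) 1 fun z => by
      rw [Complex.norm_real, Real.norm_eq_abs, Real.abs_exp, Real.exp_le_one_iff]
      nlinarith [le_max_right z.2 0]
  let unweight : (Y × ℝ → ℂ) →ₗ[ℂ] (Y × ℝ → ℂ) :=
    LinearMap.mulLeft ℂ fun z => (Real.exp (σ * z.2) : ℂ)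
  let U : (Y × ℝ →ᵇ ℂ) →ₗ[ℂ] (Y × ℝ → ℂ) :=
    { toFun := fun f => unweight ⇑(R (weight * f))
      map_add' := fun f g => by simp only [mul_add, map_add, BoundedContinuousFunction.coe_add]
      map_smul' := fun c f => by
        rw [mul_smul_comm, map_smul]
        exact unweight.map_smul c _ }
  refine ⟨U, fun f => (by fun_prop : Continuous fun z : Y × ℝ => (Real.exp (σ * z.2) : ℂ)).mul
    (R (weight * f)).continuous, fun f y t ht => ?_⟩
  refine volterra_of_weighted (v := fun s => R (weight * f) (y, s)) ?_
  have hsolve := congrArg (fun v : Y × ℝ →ᵇ ℂ => v (y, t)) (hR (weight * f))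
  simpa [weight, volterraCLM, volterraIntegral, max_eq_left ht] using hsolve

/-- The Fourier transform of the free evolution of `w` at frequency `X`, integrated over the
wavenumber, as a bounded continuous function of `(X, t)`; linear in `w`. -/
noncomputable def freeDensity (p : ℝ) : 𝓢(ℝ × ℝ, ℂ) →ₗ[ℂ] (ℝ × ℝ →ᵇ ℂ) where
  toFun w := .ofNormedAddCommGroup (fun z => fourier₂ w z.1 (2 * Real.pi * p * z.1 * z.2))
    ((continuous_fourier₂ w).comp
      (f := fun z : ℝ × ℝ => (z.1, 2 * Real.pi * p * z.1 * z.2)) (by fun_prop))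
    (exists_norm_fourier₂_le w).choose fun z => by
      obtain ⟨hA, hle⟩ := (exists_norm_fourier₂_le w).choose_spec
      refine (hle _ _).trans (mul_le_of_le_one_right hA ?_)
      exact mul_le_one₀ (inv_le_one_of_one_le₀ (by simp [sq_nonneg])) (by positivity)
        (inv_le_one_of_one_le₀ (by simp [sq_nonneg]))
  map_add' v w := by
    ext z
    exact fourier₂_add v w _ _
  map_smul' c w := by
    ext z
    exact fourier₂_smul c w _ _

theorem exists_volterra_solution (p q : ℝ) (P : 𝓢(ℝ, ℝ)) :
    ∃ U : 𝓢(ℝ × ℝ, ℂ) →ₗ[ℂ] (ℝ × ℝ → ℂ), (∀ w, Continuous (U w)) ∧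
      ∀ w X t, 0 ≤ t → U w (X, t) = fourier₂ w X (2 * Real.pi * p * X * t) +
        ∫ s in (0 : ℝ)..t, kernelH p q P (-X) (t - s) * U w (X, s) := by
  obtain ⟨M, -, hM⟩ := exists_norm_kernelH_le p q P
  obtain ⟨U, hcont, hsolve⟩ := exists_linearMap_volterra (h := fun X => kernelH p q P (-X))
    ((continuous_kernelH p q P).comp (f := fun z : ℝ × ℝ => (-z.1, z.2)) (by fun_prop))
    fun X => hM (-X)
  exact ⟨U.comp (freeDensity p), fun w => hcont _, fun w => hsolve (freeDensity p w)⟩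

end VolterraResolvent

section TimeIntegrability

theorem continuous_integral_sub_mul {k v : ℝ → ℂ} (hk : Continuous k) (hv : Continuous v) :
    Continuous fun t => ∫ s in (0 : ℝ)..t, k (t - s) * v s := by
  have hkv : Continuous (Function.uncurry fun t s : ℝ => k (t - s) * v s) :=
    (hk.comp (f := fun y : ℝ × ℝ => y.1 - y.2) (by fun_prop)).mul (hv.comp continuous_snd)
  exact intervalIntegral.continuous_parametric_intervalIntegral_of_continuous hkv continuous_id

theorem eLpNorm_integral_sub_mul_le {k v : ℝ → ℂ} (hk : Continuous k) (hv : Continuous v) :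
    eLpNorm (fun t => ∫ s in (0 : ℝ)..t, k (t - s) * v s) 2 (volume.restrict (Ioi 0)) ≤
      (∫⁻ t, ‖k t‖ₑ) * eLpNorm v 2 (volume.restrict (Ioi 0)) := by
  have hI : MeasurableSet (Ioi (0 : ℝ)) := measurableSet_Ioi
  rw [← eLpNorm_indicator_eq_eLpNorm_restrict hI, ← eLpNorm_indicator_eq_eLpNorm_restrict hI]
  refine eLpNorm_two_le_of_enorm_le_lconv hk.enorm.measurable (hv.measurable.indicator hI)
    fun t => ?_
  by_cases ht : t ∈ Ioi (0 : ℝ)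
  · rw [indicator_of_mem ht, intervalIntegral.integral_of_le (mem_Ioi.1 ht).le]
    refine (enorm_integral_le_lintegral_enorm _).trans ?_
    rw [← lintegral_indicator measurableSet_Ioc]
    refine lintegral_mono fun s => ?_
    by_cases hs : s ∈ Ioc 0 t
    · rw [indicator_of_mem hs, indicator_of_mem (mem_Ioi.2 hs.1), enorm_mul]
    · simp [indicator_of_notMem hs]
  · simp [indicator_of_notMem ht]

theorem mul_eq_of_volterra {h u f : ℝ → ℂ} (hh : Continuous h) (hu : Continuous u) {t : ℝ}
    (heq : u t = f t + ∫ s in (0 : ℝ)..t, h (t - s) * u s) :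
    (t : ℂ) * u t = ((t : ℂ) * f t + ∫ s in (0 : ℝ)..t, ((t - s : ℝ) : ℂ) * h (t - s) * u s) +
      ∫ s in (0 : ℝ)..t, h (t - s) * ((s : ℂ) * u s) := by
  rw [add_assoc, ← intervalIntegral.integral_add
    (Continuous.intervalIntegrable (by fun_prop) _ _)
    (Continuous.intervalIntegrable (by fun_prop) _ _)]
  conv_lhs => rw [heq, mul_add, ← intervalIntegral.integral_const_mul]
  congr 2 with s
  push_cast
  ring

theorem eLpNorm_two_le_ofReal {α E : Type*} [MeasurableSpace α] [NormedAddCommGroup E]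
    {f : α → E} {μ : Measure α} {y : ℝ} (hy : 0 ≤ y)
    (h : ∫⁻ t, ‖f t‖ₑ ^ 2 ∂μ ≤ ENNReal.ofReal (y ^ 2)) : eLpNorm f 2 μ ≤ ENNReal.ofReal y := by
  rwa [← ENNReal.pow_le_pow_left_iff (n := 2) two_ne_zero, eLpNorm_two_sq,
    ← ENNReal.ofReal_pow hy]

theorem lintegral_sq_le_ofReal {α E : Type*} [MeasurableSpace α] [NormedAddCommGroup E]
    {f : α → E} {μ : Measure α} {y : ℝ} (hy : 0 ≤ y)
    (h : eLpNorm f 2 μ ≤ ENNReal.ofReal y) : ∫⁻ t, ‖f t‖ₑ ^ 2 ∂μ ≤ ENNReal.ofReal (y ^ 2) := by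
  rw [← eLpNorm_two_sq, ENNReal.ofReal_pow hy]
  gcongr

theorem norm_le_inv_one_add_sq_add (z : ℂ) {a : ℝ} (ha : 0 < a) (X t : ℝ) :
    ‖z‖ ≤ a * (1 + (X * t) ^ 2)⁻¹ + (a⁻¹ * ‖z‖ ^ 2 + a⁻¹ * X ^ 2 * ‖(t : ℂ) * z‖ ^ 2) := by
  rw [norm_mul, Complex.norm_real, Real.norm_eq_abs, mul_pow |t|, sq_abs]
  set c := a * (1 + (X * t) ^ 2)⁻¹ with hc
  have hc₀ : 0 < c := by positivity
  have hweight : a⁻¹ * ‖z‖ ^ 2 + a⁻¹ * X ^ 2 * (t ^ 2 * ‖z‖ ^ 2) = c⁻¹ * ‖z‖ ^ 2 := by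
    rw [hc, mul_inv, inv_inv]
    ring
  have hsquare : c⁻¹ * (‖z‖ - c) ^ 2 = c⁻¹ * ‖z‖ ^ 2 - 2 * ‖z‖ + c := by
    field_simp
    ring
  rw [hweight]
  linarith [norm_nonneg z, show 0 ≤ c⁻¹ * (‖z‖ - c) ^ 2 by positivity]

theorem setLIntegral_enorm_le {u : ℝ → ℂ} (hu : Continuous u) {X a y₀ y₁ : ℝ} (hX : X ≠ 0)
    (ha : 0 < a) (hy₀ : 0 ≤ y₀) (hy₁ : 0 ≤ y₁)
    (h₀ : eLpNorm u 2 (volume.restrict (Ioi 0)) ≤ ENNReal.ofReal y₀)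
    (h₁ : eLpNorm (fun t : ℝ => (t : ℂ) * u t) 2 (volume.restrict (Ioi 0)) ≤ ENNReal.ofReal y₁) :
    ∫⁻ t in Ioi (0 : ℝ), ‖u t‖ₑ ≤
      ENNReal.ofReal (a * (Real.pi / |X|) + (a⁻¹ * y₀ ^ 2 + a⁻¹ * X ^ 2 * y₁ ^ 2)) := by
  have hpoint (t : ℝ) : ‖u t‖ₑ ≤ ENNReal.ofReal (a * (1 + (X * t) ^ 2)⁻¹) +
      (ENNReal.ofReal a⁻¹ * ‖u t‖ₑ ^ 2 +
        ENNReal.ofReal (a⁻¹ * X ^ 2) * ‖(t : ℂ) * u t‖ₑ ^ 2) := by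
    simp only [← ofReal_norm]
    rw [← ENNReal.ofReal_pow (norm_nonneg _), ← ENNReal.ofReal_pow (norm_nonneg _),
      ← ENNReal.ofReal_mul (by positivity), ← ENNReal.ofReal_mul (by positivity),
      ← ENNReal.ofReal_add (by positivity) (by positivity),
      ← ENNReal.ofReal_add (by positivity) (by positivity)]
    exact ENNReal.ofReal_le_ofReal (norm_le_inv_one_add_sq_add (u t) ha X t)
  have hweight : ∫⁻ t in Ioi (0 : ℝ), ENNReal.ofReal (a * (1 + (X * t) ^ 2)⁻¹) ≤
      ENNReal.ofReal (a * (Real.pi / |X|)) := by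
    refine (setLIntegral_le_lintegral _ _).trans_eq ?_
    rw [← ofReal_integral_eq_lintegral_ofReal ((integrable_inv_one_add_mul_sq hX).const_mul _)
      (.of_forall fun t => by positivity), integral_const_mul, integral_inv_one_add_mul_sq]
  have hmeas : Measurable u := hu.measurable
  refine (lintegral_mono hpoint).trans ?_
  rw [lintegral_add_left (by fun_prop), lintegral_add_left (by fun_prop),
    lintegral_const_mul _ (by fun_prop), lintegral_const_mul _ (by fun_prop),
    ENNReal.ofReal_add (by positivity) (by positivity),
    ENNReal.ofReal_add (by positivity) (by positivity),
    ENNReal.ofReal_mul (inv_nonneg.2 ha.le) (q := y₀ ^ 2),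
    ENNReal.ofReal_mul (by positivity : 0 ≤ a⁻¹ * X ^ 2)]
  gcongr
  exacts [lintegral_sq_le_ofReal hy₀ h₀, lintegral_sq_le_ofReal hy₁ h₁]

variable {p q κ A : ℝ} {P : 𝓢(ℝ, ℝ)} {w : 𝓢(ℝ × ℝ, ℂ)} {X : ℝ}

theorem lintegral_sq_mul_fourier₂_le (hp : p ≠ 0)
    (hA : ∀ X η : ℝ, ‖fourier₂ w X η‖ ≤ A * ((1 + X ^ 2)⁻¹ * (1 + η ^ 2)⁻¹)) (hX : X ≠ 0) :
    ∫⁻ t in Ioi (0 : ℝ), ‖(t : ℂ) * fourier₂ w X (2 * Real.pi * p * X * t)‖ₑ ^ 2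
      ≤ ENNReal.ofReal ((A * (1 + X ^ 2)⁻¹ / (2 * Real.pi * p * X)) ^ 2 / (2 * |p| * |X|)) := by
  set c : ℝ := 2 * Real.pi * p * X with hcdef
  have hc : c ≠ 0 := by simp [hcdef, hp, hX, Real.pi_ne_zero]
  have hbound (t : ℝ) : ‖(t : ℂ) * fourier₂ w X (c * t)‖ ^ 2 ≤
      (A * (1 + X ^ 2)⁻¹ / c) ^ 2 * (1 + (c * t) ^ 2)⁻¹ := by
    have hle : (c * t) ^ 2 * (1 + (c * t) ^ 2)⁻¹ ≤ 1 := by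
      rw [← div_eq_mul_inv, div_le_one (by positivity)]
      linarith
    rw [norm_mul, Complex.norm_real, Real.norm_eq_abs, mul_pow, sq_abs]
    calc t ^ 2 * ‖fourier₂ w X (c * t)‖ ^ 2
        ≤ t ^ 2 * (A * ((1 + X ^ 2)⁻¹ * (1 + (c * t) ^ 2)⁻¹)) ^ 2 := by
          gcongr
          exact hA X (c * t)
      _ = (A * (1 + X ^ 2)⁻¹ / c) ^ 2 * (1 + (c * t) ^ 2)⁻¹ *
          ((c * t) ^ 2 * (1 + (c * t) ^ 2)⁻¹) := by field_simp
      _ ≤ _ := mul_le_of_le_one_right (by positivity) hle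
  refine (setLIntegral_sq_le_of_sq_norm_le hc (by positivity) hbound _).trans_eq ?_
  have := abs_pos.2 hp
  have := abs_pos.2 hX
  have habs : |c| = 2 * Real.pi * |p| * |X| := by
    rw [hcdef, abs_mul, abs_mul, abs_mul, abs_two, abs_of_pos Real.pi_pos]
  rw [habs]
  congr 1
  field_simp

theorem eLpNorm_fourier₂_le (hp : p ≠ 0) (hA₀ : 0 ≤ A)
    (hA : ∀ X η : ℝ, ‖fourier₂ w X η‖ ≤ A * ((1 + X ^ 2)⁻¹ * (1 + η ^ 2)⁻¹)) (hX : X ≠ 0) :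
    eLpNorm (fun t => fourier₂ w X (2 * Real.pi * p * X * t)) 2 (volume.restrict (Ioi 0)) ≤
      ENNReal.ofReal (A * ((1 + X ^ 2)⁻¹ / √(2 * |p| * |X|))) := by
  refine eLpNorm_two_le_ofReal (by positivity) ((lintegral_sq_fourier₂_le hp hA hX).trans_eq ?_)
  rw [← mul_div_assoc, div_pow, Real.sq_sqrt (by positivity)]

theorem eLpNorm_mul_fourier₂_le (hp : p ≠ 0) (hA₀ : 0 ≤ A)
    (hA : ∀ X η : ℝ, ‖fourier₂ w X η‖ ≤ A * ((1 + X ^ 2)⁻¹ * (1 + η ^ 2)⁻¹)) (hX : X ≠ 0) :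
    eLpNorm (fun t : ℝ => (t : ℂ) * fourier₂ w X (2 * Real.pi * p * X * t)) 2
      (volume.restrict (Ioi 0)) ≤
      ENNReal.ofReal (A * ((1 + X ^ 2)⁻¹ / √(2 * |p| * |X|)) / (2 * Real.pi * |p| * |X|)) := by
  refine eLpNorm_two_le_ofReal (by positivity)
    ((lintegral_sq_mul_fourier₂_le hp hA hX).trans_eq ?_)
  rw [div_pow _ (2 * Real.pi * |p| * |X|), ← mul_div_assoc, div_pow _ √_,
    Real.sq_sqrt (by positivity), div_pow _ (2 * Real.pi * p * X)]
  simp only [mul_pow, sq_abs]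
  rw [div_right_comm]

theorem StableWith.eLpNorm_solution_le (hs : StableWith p q P κ) (hp : p ≠ 0) (hA₀ : 0 ≤ A)
    (hA : ∀ X η : ℝ, ‖fourier₂ w X η‖ ≤ A * ((1 + X ^ 2)⁻¹ * (1 + η ^ 2)⁻¹)) (hX : X ≠ 0)
    {u : ℝ → ℂ} (hu : Continuous u)
    (heq : ∀ t, 0 < t → u t = fourier₂ w X (2 * Real.pi * p * X * t) +
      ∫ s in (0 : ℝ)..t, kernelH p q P (-X) (t - s) * u s) :
    eLpNorm u 2 (volume.restrict (Ioi 0)) ≤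
      ENNReal.ofReal (A / κ * ((1 + X ^ 2)⁻¹ / √(2 * |p| * |X|))) := by
  have hκ := hs.1
  refine (hs.eLpNorm_le hp hX hu.continuousOn heq).trans
    ((mul_le_mul_right (eLpNorm_fourier₂_le hp hA₀ hA hX) _).trans_eq ?_)
  rw [← ENNReal.ofReal_mul (by positivity)]
  congr 1
  ring

theorem StableWith.eLpNorm_mul_solution_le (hs : StableWith p q P κ) (hp : p ≠ 0) (hA₀ : 0 ≤ A)
    (hA : ∀ X η : ℝ, ‖fourier₂ w X η‖ ≤ A * ((1 + X ^ 2)⁻¹ * (1 + η ^ 2)⁻¹)) {C : ℝ} (hC₀ : 0 ≤ C)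
    (hC : ∀ X, X ≠ 0 → ∫ t : ℝ, ‖(t : ℂ) * kernelH p q P X t‖ ≤ C / |X|) (hX : X ≠ 0)
    {u : ℝ → ℂ} (hu : Continuous u)
    (heq : ∀ t, 0 < t → u t = fourier₂ w X (2 * Real.pi * p * X * t) +
      ∫ s in (0 : ℝ)..t, kernelH p q P (-X) (t - s) * u s) :
    eLpNorm (fun t : ℝ => (t : ℂ) * u t) 2 (volume.restrict (Ioi 0)) ≤
      ENNReal.ofReal ((A / (2 * Real.pi * |p|) + C * (A / κ)) / κ *
        ((1 + X ^ 2)⁻¹ / √(2 * |p| * |X|)) / |X|) := by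
  have hκ := hs.1
  have hX' : -X ≠ 0 := neg_ne_zero.2 hX
  have hfree : Continuous fun t => fourier₂ w X (2 * Real.pi * p * X * t) :=
    (continuous_fourier₂ w).comp (f := fun t : ℝ => (X, 2 * Real.pi * p * X * t)) (by fun_prop)
  have hkernel := continuous_kernelH_right p q P (-X)
  have hmoment : Continuous fun t : ℝ => (t : ℂ) * kernelH p q P (-X) t := by fun_prop
  have hmoment_le : ∫⁻ t : ℝ, ‖(t : ℂ) * kernelH p q P (-X) t‖ₑ ≤ ENNReal.ofReal (C / |X|) := by
    rw [← ofReal_integral_norm_eq_lintegral_enorm (integrable_mul_kernelH hp q P hX'), ← abs_neg]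
    exact ENNReal.ofReal_le_ofReal (hC (-X) hX')
  have hforcing := (eLpNorm_add_le
    (by fun_prop : Continuous fun t : ℝ =>
      (t : ℂ) * fourier₂ w X (2 * Real.pi * p * X * t)).aestronglyMeasurable
    (continuous_integral_sub_mul hmoment hu).aestronglyMeasurable one_le_two).trans
    (add_le_add (eLpNorm_mul_fourier₂_le hp hA₀ hA hX)
      ((eLpNorm_integral_sub_mul_le hmoment hu).trans
        (mul_le_mul' hmoment_le (hs.eLpNorm_solution_le hp hA₀ hA hX hu heq))))
  refine (hs.eLpNorm_le hp hX (u := fun t : ℝ => (t : ℂ) * u t)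
    (by fun_prop : Continuous _).continuousOn
    fun t ht => mul_eq_of_volterra (f := fun t => fourier₂ w X (2 * Real.pi * p * X * t))
      hkernel hu (heq t ht)).trans ?_
  refine (mul_le_mul_right hforcing _).trans_eq ?_
  rw [← ENNReal.ofReal_mul (by positivity), ← ENNReal.ofReal_add (by positivity) (by positivity),
    ← ENNReal.ofReal_mul (by positivity)]
  congr 1
  field_simp

theorem StableWith.exists_setLIntegral_solution_le (hs : StableWith p q P κ) (hp : p ≠ 0)
    (w : 𝓢(ℝ × ℝ, ℂ)) :
    ∃ B : ℝ, ∀ X, X ≠ 0 → ∀ u : ℝ → ℂ, Continuous u →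
      (∀ t, 0 < t → u t = fourier₂ w X (2 * Real.pi * p * X * t) +
        ∫ s in (0 : ℝ)..t, kernelH p q P (-X) (t - s) * u s) →
      ∫⁻ t in Ioi (0 : ℝ), ‖u t‖ₑ ≤ ENNReal.ofReal (B * ((1 + X ^ 2)⁻¹ / |X|)) := by
  obtain ⟨A, hA₀, hA⟩ := exists_norm_fourier₂_le w
  obtain ⟨C, hC₀, hC⟩ := exists_integral_norm_mul_kernelH_le hp q P
  have hκ := hs.1
  have := abs_pos.2 hp
  refine ⟨Real.pi + ((A / κ) ^ 2 + ((A / (2 * Real.pi * |p|) + C * (A / κ)) / κ) ^ 2) / (2 * |p|),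
    fun X hX u hu heq => ?_⟩
  have := abs_pos.2 hX
  refine (setLIntegral_enorm_le hu hX (a := (1 + X ^ 2)⁻¹) (by positivity) (by positivity)
    (by positivity) (hs.eLpNorm_solution_le hp hA₀ hA hX hu heq)
    (hs.eLpNorm_mul_solution_le hp hA₀ hA hC₀ hC hX hu heq)).trans_eq ?_
  simp only [div_pow, mul_pow, Real.sq_sqrt (show 0 ≤ 2 * |p| * |X| by positivity), ← sq_abs X]
  congr 1
  field_simp

end TimeIntegrability

section WaveOperator

theorem exists_norm_gap_le (P : 𝓢(ℝ, ℝ)) : ∃ L : ℝ, ∀ k X, ‖gap P k X‖ ≤ L * |X| := by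
  refine ⟨SchwartzMap.seminorm ℝ 0 0 (SchwartzMap.derivCLM ℝ ℝ P), fun k X => ?_⟩
  have hmean := convex_univ.norm_image_sub_le_of_norm_deriv_le (𝕜 := ℝ) (f := P)
    (fun x _ => P.differentiableAt)
    (fun x _ => SchwartzMap.norm_le_seminorm ℝ (SchwartzMap.derivCLM ℝ ℝ P) x)
    (mem_univ (k + X / 2)) (mem_univ (k - X / 2))
  have hdist : k - X / 2 - (k + X / 2) = -X := by ring
  rwa [hdist, norm_neg, Real.norm_eq_abs X, ← Complex.norm_real] at hmean

/-- The contribution of a unit density mode of frequency `ζ.1` at time `ζ.2` to the asymptotic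
state at the phase-space point `z`: the mode is carried along the free flow and weighted by the
gap of the background spectrum. -/
noncomputable def amplitude (p : ℝ) (P : ℝ → ℝ) (z ζ : ℝ × ℝ) : ℂ :=
  Complex.exp (2 * Real.pi * Complex.I * ζ.1 * (z.1 + 2 * Real.pi * p * z.2 * ζ.2 : ℝ)) *
    gap P z.2 ζ.1

theorem continuous_amplitude (p : ℝ) (P : 𝓢(ℝ, ℝ)) :
    Continuous fun y : (ℝ × ℝ) × (ℝ × ℝ) => amplitude p P y.1 y.2 := by
  have hgap : Continuous fun y : (ℝ × ℝ) × (ℝ × ℝ) => gap P y.1.2 y.2.1 :=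
    (continuous_gap P).comp (f := fun y : (ℝ × ℝ) × (ℝ × ℝ) => (y.1.2, y.2.1)) (by fun_prop)
  unfold amplitude
  fun_prop

theorem norm_amplitude_mul_le {P : ℝ → ℝ} {L : ℝ} (hL : ∀ k X, ‖gap P k X‖ ≤ L * |X|) (p : ℝ)
    (z ζ : ℝ × ℝ) (v : ℂ) : ‖amplitude p P z ζ * v‖ ≤ L * (|ζ.1| * ‖v‖) := by
  rw [amplitude, norm_mul, norm_mul, ← mul_assoc]
  refine mul_le_mul_of_nonneg_right ?_ (norm_nonneg v)
  simpa [Complex.norm_exp] using hL z.2 ζ.1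

/-- The state whose free evolution is asymptotic to the solution with datum `w₀`, where `u` is the
Fourier transform in space of the density of that solution. -/
noncomputable def asymptoticState (p q : ℝ) (P : ℝ → ℝ) (w₀ u : ℝ × ℝ → ℂ) (z : ℝ × ℝ) : ℂ :=
  w₀ z + q * Complex.I * ∫ ζ, amplitude p P z ζ * u ζ ∂spaceTime

variable {p q κ : ℝ} {P : 𝓢(ℝ, ℝ)} {w₀ : 𝓢(ℝ × ℝ, ℂ)} {w : ℝ → 𝓢(ℝ × ℝ, ℂ)} {u : ℝ × ℝ → ℂ}

theorem StableWith.integrable_abs_mul_norm_solution (hs : StableWith p q P κ) (hp : p ≠ 0)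
    (hu : Continuous u)
    (heq : ∀ X t, 0 < t → u (X, t) = fourier₂ w₀ X (2 * Real.pi * p * X * t) +
      ∫ s in (0 : ℝ)..t, kernelH p q P (-X) (t - s) * u (X, s)) :
    Integrable (fun ζ : ℝ × ℝ => |ζ.1| * ‖u ζ‖) spaceTime := by
  obtain ⟨B, hB⟩ := hs.exists_setLIntegral_solution_le hp w₀
  have hcont : Continuous fun ζ : ℝ × ℝ => |ζ.1| * ‖u ζ‖ := by fun_prop
  refine ⟨hcont.aestronglyMeasurable, ?_⟩
  rw [HasFiniteIntegral, lintegral_prod _ hcont.enorm.measurable.aemeasurable]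
  calc ∫⁻ X, ∫⁻ t in Ioi (0 : ℝ), ‖|X| * ‖u (X, t)‖‖ₑ
      ≤ ∫⁻ X, ENNReal.ofReal (B * (1 + X ^ 2)⁻¹) := by
        refine lintegral_mono_ae ((Measure.ae_ne volume (0 : ℝ)).mono fun X hX => ?_)
        have hX' : 0 < |X| := abs_pos.2 hX
        have hux : Continuous fun t : ℝ => u (X, t) := by fun_prop
        simp only [enorm_mul, enorm_norm]
        rw [lintegral_const_mul _ hux.enorm.measurable]
        refine (mul_le_mul_right (hB X hX _ hux (heq X)) _).trans_eq ?_
        rw [← ofReal_norm, norm_abs_eq_norm, Real.norm_eq_abs, ← ENNReal.ofReal_mul hX'.le]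
        congr 1
        field_simp
    _ < ∞ := (integrable_inv_one_add_sq.const_mul B).lintegral_lt_top

theorem integrable_amplitude_mul (hu : Continuous u)
    (hint : Integrable (fun ζ : ℝ × ℝ => |ζ.1| * ‖u ζ‖) spaceTime) (z : ℝ × ℝ) :
    Integrable (fun ζ => amplitude p P z ζ * u ζ) spaceTime := by
  obtain ⟨L, hL⟩ := exists_norm_gap_le P
  have hamplitude : Continuous fun ζ => amplitude p P z ζ :=
    (continuous_amplitude p P).comp (f := fun ζ => (z, ζ)) (by fun_prop)
  exact (hint.const_mul L).mono' (hamplitude.mul hu).aestronglyMeasurable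
    (.of_forall fun ζ => norm_amplitude_mul_le hL p z ζ (u ζ))

theorem memLp_top_asymptoticState (p q : ℝ) (P : 𝓢(ℝ, ℝ)) (w₀ : 𝓢(ℝ × ℝ, ℂ)) (hu : Continuous u)
    (hint : Integrable (fun ζ : ℝ × ℝ => |ζ.1| * ‖u ζ‖) spaceTime) :
    MemLp (asymptoticState p q P w₀ u) ∞ volume := by
  obtain ⟨L, hL⟩ := exists_norm_gap_le P
  have hcont : Continuous fun z => ∫ ζ, amplitude p P z ζ * u ζ ∂spaceTime :=
    continuous_of_dominated (fun z => (integrable_amplitude_mul hu hint z).aestronglyMeasurable)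
      (fun z => .of_forall fun ζ => norm_amplitude_mul_le hL p z ζ (u ζ)) (hint.const_mul L)
      (.of_forall fun ζ => ((continuous_amplitude p P).comp
        (f := fun z => (z, ζ)) (by fun_prop)).mul continuous_const)
  refine (w₀.memLp ∞).add (memLp_top_of_bound (continuous_const.mul hcont).aestronglyMeasurable
    (|q| * ∫ ζ : ℝ × ℝ, L * (|ζ.1| * ‖u ζ‖) ∂spaceTime) (.of_forall fun z => ?_))
  rw [Pi.mul_apply, norm_mul, norm_mul, Complex.norm_I, mul_one, Complex.norm_real,
    Real.norm_eq_abs]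
  gcongr
  exact norm_integral_le_of_norm_le (hint.const_mul L)
    (.of_forall fun ζ => norm_amplitude_mul_le hL p z ζ (u ζ))

theorem IsSolution.fourier_density_eq_of_volterra (hw : IsSolution p q P w₀ w) {X : ℝ}
    {u : ℝ → ℂ} (hu : Continuous u)
    (heq : ∀ t, 0 < t → u t = fourier₂ w₀ X (2 * Real.pi * p * X * t) +
      ∫ s in (0 : ℝ)..t, kernelH p q P (-X) (t - s) * u s) {t : ℝ} (ht : 0 < t) :
    𝓕 (densityCLM (w t)) X = u t := by
  obtain ⟨M, -, hM⟩ := exists_norm_kernelH_le p q P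
  exact eqOn_of_volterra (f := fun t => fourier₂ w₀ X (2 * Real.pi * p * X * t))
    (continuous_kernelH_right p q P (-X)) (hM (-X))
    (continuousOn_schwartz_apply hw.continuousOn_fourier_density X) hu.continuousOn
    (fun t ht => hw.volterra X ht.le) heq ht

theorem spaceTime_restrict_univ_prod_Iic (t : ℝ) :
    spaceTime.restrict (univ ×ˢ Iic t) = volume.prod (volume.restrict (Ioc 0 t)) := by
  rw [← Measure.prod_restrict, Measure.restrict_univ, Measure.restrict_restrict measurableSet_Iic,
    inter_comm, Ioi_inter_Iic]

theorem integrable_cexp_mul_fourier_sliceX (f : 𝓢(ℝ × ℝ, ℂ)) (y k : ℝ) :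
    Integrable fun X : ℝ => Complex.exp (2 * Real.pi * Complex.I * X * y) * 𝓕 (sliceX k f) X :=
  integrable_cexp_mul (by fun_prop) (by simp) (𝓕 (sliceX k f)).integrable

theorem apply_eq_integral_fourier_sliceX (f : 𝓢(ℝ × ℝ, ℂ)) (y k : ℝ) :
    f (y, k) = ∫ X : ℝ, Complex.exp (2 * Real.pi * Complex.I * X * y) * 𝓕 (sliceX k f) X := by
  calc f (y, k) = 𝓕⁻ (𝓕 (sliceX k f)) y := by
        rw [FourierTransform.fourierInv_fourier_eq, sliceX_apply]
    _ = _ := by rw [SchwartzMap.fourierInv_coe, fourierInv_eq_integral]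

theorem IsSolution.cexp_mul_fourier_sliceX_eq (hw : IsSolution p q P w₀ w) {t : ℝ} (ht : 0 ≤ t)
    (x k X : ℝ) :
    Complex.exp (2 * Real.pi * Complex.I * X * (x + 2 * Real.pi * p * k * t : ℝ)) *
        𝓕 (sliceX k (w t)) X =
      Complex.exp (2 * Real.pi * Complex.I * X * x) * 𝓕 (sliceX k w₀) X +
        q * Complex.I *
          ∫ s in Ioc 0 t, amplitude p P (x, k) (X, s) * 𝓕 (densityCLM (w s)) X := by
  rw [hw.fourier_sliceX_eq k X ht, intervalIntegral.integral_of_le ht, mul_add, ← mul_assoc,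
    ← Complex.exp_add, ← integral_const_mul, ← integral_const_mul]
  refine congrArg₂ (· + ·) ?_ (setIntegral_congr_fun measurableSet_Ioc fun s _ => ?_)
  · congr 2
    push_cast
    ring
  · have hphase : Complex.exp (2 * Real.pi * Complex.I * X * (x + 2 * Real.pi * p * k * s : ℝ)) =
        Complex.exp (2 * Real.pi * Complex.I * X * (x + 2 * Real.pi * p * k * t : ℝ)) *
          Complex.exp (-2 * Real.pi * Complex.I * (2 * Real.pi * p * X * (t - s) : ℝ) * k) := by
      rw [← Complex.exp_add]
      congr 1
      push_cast
      ring
    simp only [amplitude, hphase]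
    ring

theorem IsSolution.apply_eq (hw : IsSolution p q P w₀ w) (hu : Continuous u)
    (hint : Integrable (fun ζ : ℝ × ℝ => |ζ.1| * ‖u ζ‖) spaceTime)
    (hwu : ∀ X t, 0 < t → 𝓕 (densityCLM (w t)) X = u (X, t)) {t : ℝ} (ht : 0 ≤ t) (x k : ℝ) :
    w t (x + 2 * Real.pi * p * k * t, k) = w₀ (x, k) + q * Complex.I *
      ∫ ζ in univ ×ˢ Iic t, amplitude p P (x, k) ζ * u ζ ∂spaceTime := by
  have hrestrict := (integrable_amplitude_mul (p := p) (P := P) hu hint (x, k)).restrict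
    (s := univ ×ˢ Iic t)
  rw [spaceTime_restrict_univ_prod_Iic] at hrestrict ⊢
  calc w t (x + 2 * Real.pi * p * k * t, k)
      = ∫ X : ℝ, (Complex.exp (2 * Real.pi * Complex.I * X * x) * 𝓕 (sliceX k w₀) X +
          q * Complex.I * ∫ s in Ioc 0 t, amplitude p P (x, k) (X, s) * u (X, s)) := by
        rw [apply_eq_integral_fourier_sliceX]
        congr 1 with X
        rw [hw.cexp_mul_fourier_sliceX_eq ht]
        congr 2
        exact setIntegral_congr_fun measurableSet_Ioc fun s hs => by rw [hwu X s hs.1]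
    _ = w₀ (x, k) + q * Complex.I *
          ∫ X : ℝ, ∫ s in Ioc 0 t, amplitude p P (x, k) (X, s) * u (X, s) := by
        rw [integral_add (integrable_cexp_mul_fourier_sliceX w₀ x k)
          (hrestrict.integral_prod_left.const_mul _), integral_const_mul,
          ← apply_eq_integral_fourier_sliceX]
    _ = _ := by rw [integral_prod _ hrestrict]

theorem IsSolution.norm_sub_freeTransport_le (hw : IsSolution p q P w₀ w) (hu : Continuous u)
    (hint : Integrable (fun ζ : ℝ × ℝ => |ζ.1| * ‖u ζ‖) spaceTime)
    (hwu : ∀ X t, 0 < t → 𝓕 (densityCLM (w t)) X = u (X, t)) {L : ℝ}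
    (hL : ∀ k X, ‖gap P k X‖ ≤ L * |X|) {t : ℝ} (ht : 0 ≤ t) (z : ℝ × ℝ) :
    ‖w t z - freeTransport p t (asymptoticState p q P w₀ u) z‖ ≤
      |q| * ∫ ζ in (univ ×ˢ Iic t)ᶜ, L * (|ζ.1| * ‖u ζ‖) ∂spaceTime := by
  set z' : ℝ × ℝ := (z.1 - 2 * Real.pi * p * z.2 * t, z.2) with hz'
  have hz : z = (z'.1 + 2 * Real.pi * p * z'.2 * t, z'.2) := by simp [hz']
  have htail : w t z - freeTransport p t (asymptoticState p q P w₀ u) z =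
      -(q * Complex.I * ∫ ζ in (univ ×ˢ Iic t)ᶜ, amplitude p P z' ζ * u ζ ∂spaceTime) := by
    rw [freeTransport, ← hz', asymptoticState, ← integral_add_compl
      (MeasurableSet.univ.prod (measurableSet_Iic (a := t))) (integrable_amplitude_mul hu hint z')]
    conv_lhs => rw [hz, hw.apply_eq hu hint hwu ht]
    ring
  rw [htail, norm_neg, norm_mul, norm_mul, Complex.norm_I, mul_one, Complex.norm_real,
    Real.norm_eq_abs]
  gcongr
  exact norm_integral_le_of_norm_le (hint.const_mul L).integrableOn
    (.of_forall fun ζ => norm_amplitude_mul_le hL p z' ζ (u ζ))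

theorem tendsto_setIntegral_compl_univ_prod_Iic {α E : Type*} [MeasurableSpace α]
    [NormedAddCommGroup E] [NormedSpace ℝ E] {μ : Measure (α × ℝ)} {f : α × ℝ → E}
    (hf : Integrable f μ) :
    Tendsto (fun t => ∫ ζ in (univ ×ˢ Iic t)ᶜ, f ζ ∂μ) atTop (𝓝 0) := by
  have hempty : ⋂ t : ℝ, ((univ : Set α) ×ˢ Iic t)ᶜ = ∅ := by
    ext ζ
    simpa using ⟨ζ.2, le_rfl⟩
  have htendsto := tendsto_setIntegral_of_antitone (μ := μ) (f := f)
    (fun t => (MeasurableSet.univ.prod (measurableSet_Iic (a := t))).compl)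
    (fun s t hst => compl_subset_compl.2 (prod_mono le_rfl (Iic_subset_Iic.2 hst)))
    ⟨0, hf.integrableOn⟩
  rwa [hempty, setIntegral_empty] at htendsto

theorem IsSolution.tendsto_eLpNorm_sub_freeTransport (hw : IsSolution p q P w₀ w)
    (hu : Continuous u) (hint : Integrable (fun ζ : ℝ × ℝ => |ζ.1| * ‖u ζ‖) spaceTime)
    (hwu : ∀ X t, 0 < t → 𝓕 (densityCLM (w t)) X = u (X, t)) :
    Tendsto (fun t : ℝ => eLpNorm
      (fun z : ℝ × ℝ => w t z - freeTransport p t (asymptoticState p q P w₀ u) z) ∞ volume)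
      atTop (𝓝 0) := by
  obtain ⟨L, hL⟩ := exists_norm_gap_le P
  have htail := ENNReal.tendsto_ofReal
    ((tendsto_setIntegral_compl_univ_prod_Iic (hint.const_mul L)).const_mul |q|)
  rw [mul_zero, ENNReal.ofReal_zero] at htail
  refine tendsto_of_tendsto_of_tendsto_of_le_of_le' tendsto_const_nhds htail
    (.of_forall fun _ => zero_le) ((eventually_ge_atTop 0).mono fun t ht => ?_)
  exact eLpNormEssSup_le_of_ae_bound
    (.of_forall fun z => hw.norm_sub_freeTransport_le hu hint hwu hL ht z)

theorem StableWith.exists_waveOperator (hs : StableWith p q P κ) (hp : p ≠ 0) :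
    ∃ W : 𝓢(ℝ × ℝ, ℂ) →ₗ[ℂ] (ℝ × ℝ → ℂ),
      (∀ w₀ : 𝓢(ℝ × ℝ, ℂ), MemLp (W w₀) ∞ volume) ∧
      ∀ (w₀ : 𝓢(ℝ × ℝ, ℂ)) (w : ℝ → 𝓢(ℝ × ℝ, ℂ)), IsSolution p q P w₀ w →
        Tendsto (fun t : ℝ => eLpNorm
          (fun z : ℝ × ℝ => w t z - freeTransport p t (W w₀) z) ∞ volume) atTop (𝓝 0) := by
  obtain ⟨U, hcont, hU⟩ := exists_volterra_solution p q P
  have hint (w : 𝓢(ℝ × ℝ, ℂ)) := hs.integrable_abs_mul_norm_solution hp (hcont w)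
    fun X t ht => hU w X t ht.le
  have hamp (w : 𝓢(ℝ × ℝ, ℂ)) := integrable_amplitude_mul (p := p) (P := P) (hcont w) (hint w)
  let W : 𝓢(ℝ × ℝ, ℂ) →ₗ[ℂ] (ℝ × ℝ → ℂ) :=
    { toFun := fun w => asymptoticState p q P w (U w)
      map_add' := fun v w => by
        ext z
        simp only [asymptoticState, map_add, Pi.add_apply, mul_add, add_apply,
          integral_add (hamp v z) (hamp w z)]
        ring
      map_smul' := fun c w => by
        ext z
        simp only [asymptoticState, map_smul, Pi.smul_apply, smul_eq_mul, smul_apply,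
          RingHom.id_apply, mul_left_comm _ c, integral_const_mul, mul_add] }
  refine ⟨W, fun w => memLp_top_asymptoticState p q P w (hcont w) (hint w), fun w₀ w hw => ?_⟩
  refine hw.tendsto_eLpNorm_sub_freeTransport (hcont w₀) (hint w₀) fun X t ht => ?_
  exact hw.fourier_density_eq_of_volterra (u := fun s => U w₀ (X, s)) (by fun_prop)
    (fun s hs => hU w₀ X s hs.le) ht

end WaveOperator

end Alber

theorem theorem3p4_general (p q : ℝ) (hp : p ≠ 0) (P : 𝓢(ℝ, ℝ))
    (hstable : ∃ κ : ℝ, Alber.StableWith p q P κ) :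
    (∃ r : ℕ, ∃ C : ℝ, 0 < C ∧ ∀ κ : ℝ, Alber.StableWith p q P κ →
      ∀ (w₀ : 𝓢(ℝ × ℝ, ℂ)) (w : ℝ → 𝓢(ℝ × ℝ, ℂ)), Alber.IsSolution p q P w₀ w →
        eLpNorm (fun z : ℝ × ℝ => deriv (Alber.density (w z.2)) z.1) 2
            ((volume : Measure ℝ).prod ((volume : Measure ℝ).restrict (Set.Ioi 0)))
          ≤ ENNReal.ofReal (C / κ) * Alber.sigmaNorm r ∞ w₀) ∧
    (∃ W : 𝓢(ℝ × ℝ, ℂ) →ₗ[ℂ] (ℝ × ℝ → ℂ),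
      (∀ w₀ : 𝓢(ℝ × ℝ, ℂ), MemLp (W w₀) ∞ volume) ∧
      ∀ (w₀ : 𝓢(ℝ × ℝ, ℂ)) (w : ℝ → 𝓢(ℝ × ℝ, ℂ)), Alber.IsSolution p q P w₀ w →
        Filter.Tendsto
          (fun t : ℝ => eLpNorm
            (fun z : ℝ × ℝ => w t z - Alber.freeTransport p t (W w₀) z) ∞ volume)
          Filter.atTop (nhds 0)) := by
  have := abs_pos.2 hp
  obtain ⟨κ, hκ⟩ := hstable
  exact ⟨⟨8, 16 * Real.pi ^ 2 * √(2 * Real.pi ^ 3 / |p|), by positivity,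
    fun κ' hκ' w₀ w hw => hw.eLpNorm_deriv_density_le hp hκ'⟩, hκ.exists_waveOperator hp⟩

theorem theorem3p4 (p q : ℝ) (hp : p ≠ 0) (P : 𝓢(ℝ, ℝ)) (hP : HasCompactSupport P)
    (hstable : ∃ κ : ℝ, Alber.StableWith p q P κ) :
    (∃ r : ℕ, ∃ C : ℝ, 0 < C ∧ ∀ κ : ℝ, Alber.StableWith p q P κ →
      ∀ (w₀ : 𝓢(ℝ × ℝ, ℂ)) (w : ℝ → 𝓢(ℝ × ℝ, ℂ)), Alber.IsSolution p q P w₀ w →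
        eLpNorm (fun z : ℝ × ℝ => deriv (Alber.density (w z.2)) z.1) 2
            ((volume : Measure ℝ).prod ((volume : Measure ℝ).restrict (Set.Ioi 0)))
          ≤ ENNReal.ofReal (C / κ) * Alber.sigmaNorm r ∞ w₀) ∧
    (∃ W : 𝓢(ℝ × ℝ, ℂ) →ₗ[ℂ] (ℝ × ℝ → ℂ),
      (∀ w₀ : 𝓢(ℝ × ℝ, ℂ), MemLp (W w₀) ∞ volume) ∧
      ∀ (w₀ : 𝓢(ℝ × ℝ, ℂ)) (w : ℝ → 𝓢(ℝ × ℝ, ℂ)), Alber.IsSolution p q P w₀ w →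
        Filter.Tendsto
          (fun t : ℝ => eLpNorm
            (fun z : ℝ × ℝ => w t z - Alber.freeTransport p t (W w₀) z) ∞ volume)
          Filter.atTop (nhds 0)) :=
  theorem3p4_general p q hp P hstable
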